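/- Let $\Sigma$ be a first-order signature, $R$ a new $n$-ary relation symbol, and $V=\{v_1,\dots,v_n\}$ a set of $n$ distinct variables. Let $\Phi(R)$ be a $\Pi^1_1$ sentence over $\Sigma$, that is, a sentence $\forall S_1\cdots\forall S_k\,\forall f_1\cdots\forall f_l\ \varphi$ where the $S_i$ and $f_j$ are relation and function variables and $\varphi$ is a first-order sentence over $\Sigma\cup\{R,S_1,\dots,S_k,f_1,\dots,f_l\}$. Suppose that $R$ occurs only positively in $\Phi(R)$. Then there is a formula $\psi$ of Paraconsistent Non-dependence Logic over $\Sigma$ with free variables in $V$ such that, for every $\Sigma$-model $M$ with nonempty domain and every team $X$ over $M$ whose domain contains $V$, $$(M,X)\models^{+}_{P}\psi \iff X\neq\emptyset \text{ and } M\models\Phi(X(V)),\qquad\text{where } X(V)=\{(s(v_1),\dots,s(v_n)) : s\in X\}.$$ In particular, for nonempty teams $X$, $(M,X)\models^{+}_{P}\psi$ if and only if $M\models\Phi(X(V))$. Here the formulas of Paraconsistent Non-dependence Logic are $\psi ::= P\vec t \mid t_1=t_2 \mid {=}(\vec t_1,\vec t_2)\mid \neg\psi\mid\psi\vee\psi\mid\exists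 v\,\psi$, where $P$ ranges over the relation symbols of $\Sigma$. A team over $M$ with domain $W$ is a set of assignments $s:W\to M$. In the semantic game for $\psi$ on $(M,X)$, positions are triples (instance of a subformula, assignment $s$, player $\alpha$), and the game starts at $(\psi,s,\text{Eloise})$ for an arbitrary $s\in X$. At $\neg\theta$ the roles are swapped, i.e. $\alpha$ is replaced by the opponent and the game continues with $\theta$; at $\theta_1\vee\theta_2$ player $\alpha$ chooses a disjunct; at $\exists v\,\theta$ player $\alpha$ chooses a value $m\in M$ and $s$ becomes $s[m/v]$. At $P\vec t$ and $t_1=t_2$ player $\alpha$ wins if the atom is true under $s$, and otherwise the opponent wins; at ${=}(\vec t_1,\vec t_2)$ player $\alpha$ wins. Strategies may be nondeterministic (they allow a nonempty set of moves). A strategy for player $\beta$ is uniform if, for any two plays following it that end at the same instance of a dependence atom ${=}(\vec t_1,\vec t_2)$ with player $\beta$ and with assignments $s,s'$, equal values of $\vec t_1$ under $s$ and $s'$ imply equal values of $\vec t_2$. Finally, $(M,X)\models^{+}_{P}\psi$ means that Abelard has no uniform winning strategy in this game. -/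

import Mathlib

universe u v w

open scoped FirstOrder

/-! ## Syntax -/

/-- Formulas of Paraconsistent Non-dependence Logic (the same as those of Dependence Logic) over the
first-order signature `L`. The variables are the natural numbers. Conjunction, the universal
quantifier and the non-dependence atom `neg (dep ts us)` are the usual abbreviations. -/
inductive PDLFormula (L : FirstOrder.Language.{u, v}) : Type (max u v)
  /-- the relational atom `R t₁ … tₖ` -/
  | rel {k : ℕ} (R : L.Relations k) (ts : Fin k → L.Term ℕ) : PDLFormula L
  /-- the identity atom `t₁ = t₂` -/
  | eq (t₁ t₂ : L.Term ℕ) : PDLFormula L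
  /-- the dependence atom `=(ts, us)`, for tuples of terms `ts` and `us` -/
  | dep (ts us : List (L.Term ℕ)) : PDLFormula L
  | neg (ψ : PDLFormula L) : PDLFormula L
  | or (ψ θ : PDLFormula L) : PDLFormula L
  | ex (x : ℕ) (ψ : PDLFormula L) : PDLFormula L

namespace PDLFormula

variable {L : FirstOrder.Language.{u, v}}

/-- The set of the free variables of a formula. -/
def free : PDLFormula L → Set ℕ
  | rel _ ts => {x | ∃ i, x ∈ (ts i).varFinset}
  | eq t₁ t₂ => {x | x ∈ t₁.varFinset ∨ x ∈ t₂.varFinset}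
  | dep ts us => {x | ∃ t, (t ∈ ts ∨ t ∈ us) ∧ x ∈ t.varFinset}
  | neg ψ => ψ.free
  | or ψ θ => ψ.free ∪ θ.free
  | ex x ψ => ψ.free \ {x}

end PDLFormula

/-! ## Assignments and teams -/

/-- A variable assignment over `M`, defined on some of the variables. -/
abbrev PDLAssignment (M : Type w) : Type w := ℕ → Option M

namespace PDLAssignment

/-- The domain of an assignment. -/
def dom {M : Type w} (s : PDLAssignment M) : Set ℕ := {x | s x ≠ none}

/-- The value `s(x)` of a variable. Outside the domain of `s` it is an arbitrary element; such values
play no role in the evaluation of formulas whose free variables belong to the domain. -/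
noncomputable def val {M : Type w} [Nonempty M] (s : PDLAssignment M) (x : ℕ) : M :=
  (s x).getD (Classical.arbitrary M)

end PDLAssignment

/-- `X` is a team over `M` with domain `W`: all its assignments have domain `W`. -/
def IsTeamOn {M : Type w} (W : Set ℕ) (X : Set (PDLAssignment M)) : Prop :=
  ∀ s ∈ X, s.dom = W

/-- The relation `X(x₁ … xₙ) = {(s(x₁), …, s(xₙ)) : s ∈ X}`. -/
def teamRel {M : Type w} {n : ℕ} (X : Set (PDLAssignment M)) (x : Fin n → ℕ) : Set (Fin n → M) :=
  {a | ∃ s ∈ X, ∀ i, s (x i) = some (a i)}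

/-! ## The semantic game -/

/-- The two players. -/
inductive PDLPlayer : Type
  | eloise
  | abelard

/-- The opponent of a player. -/
def PDLPlayer.opp : PDLPlayer → PDLPlayer
  | eloise => abelard
  | abelard => eloise

/-- A position of the game: an instance of a subformula, an assignment and a player. The instance is
the subformula `form` together with its place `addr` in the syntax tree of the initial formula: the
list of the steps that lead to it from the root, the most recent one first, where `true` is a step
to a right disjunct and `false` is any other step to an immediate subformula. -/
structure PDLPosition (L : FirstOrder.Language.{u, v}) (M : Type w) : Type (max u v w) where
  addr : List Bool
  form : PDLFormula L
  asg : PDLAssignment M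
  player : PDLPlayer

namespace PDLPosition

variable {L : FirstOrder.Language.{u, v}} {M : Type w}

/-- The possible next positions. -/
def succ : PDLPosition L M → Set (PDLPosition L M)
  | ⟨d, .neg ψ, s, α⟩ => {⟨false :: d, ψ, s, α.opp⟩}
  | ⟨d, .or ψ θ, s, α⟩ => {⟨false :: d, ψ, s, α⟩, ⟨true :: d, θ, s, α⟩}
  | ⟨d, .ex x ψ, s, α⟩ => {q | ∃ m : M, q = ⟨false :: d, ψ, Function.update s x (some m), α⟩}
  | _ => ∅

/-- The position `(ψ, s, α)` is one where the game ends, that is, `ψ` is atomic. -/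
def IsTerminal (p : PDLPosition L M) : Prop :=
  match p.form with
  | .rel _ _ => True
  | .eq _ _ => True
  | .dep _ _ => True
  | _ => False

/-- The position is terminal and player `β` wins there: at a relational or identity atom, the player
of the position wins if the atom is true in the usual first-order sense and the opponent wins
otherwise; at a dependence atom, the player of the position wins. -/
def WonBy [Nonempty M] [L.Structure M] (β : PDLPlayer) (p : PDLPosition L M) : Prop :=
  match p.form with
  | .rel R ts =>
      p.player = β ↔ FirstOrder.Language.Structure.RelMap R (fun i => (ts i).realize p.asg.val)
  | .eq t₁ t₂ => p.player = β ↔ t₁.realize p.asg.val = t₂.realize p.asg.val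
  | .dep _ _ => p.player = β
  | _ => False

end PDLPosition

/-- A (nondeterministic) strategy for player `β`: it assigns to every partial play, given by the list
`h` of the previous positions (the most recent one first) and the current position `p`, a nonempty
set of possible next positions whenever the player of `p` is `β` and the game does not end at `p`. -/
structure PDLStrategy (L : FirstOrder.Language.{u, v}) (M : Type w) (β : PDLPlayer) :
    Type (max u v w) where
  choice : List (PDLPosition L M) → PDLPosition L M → Set (PDLPosition L M)
  choice_subset : ∀ h p, p.player = β → ¬ p.IsTerminal → choice h p ⊆ p.succ
  choice_nonempty : ∀ h p, p.player = β → ¬ p.IsTerminal → (choice h p).Nonempty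

namespace PDLStrategy

variable {L : FirstOrder.Language.{u, v}} {M : Type w} {β : PDLPlayer}

/-- `σ.Play X ψ h p`: there is a partial play of the game for `ψ` that starts from some assignment in
`X`, in which player `β` follows `σ`, with previous positions `h` (the most recent one first) and
current position `p`. -/
inductive Play (σ : PDLStrategy L M β) (X : Set (PDLAssignment M)) (ψ : PDLFormula L) :
    List (PDLPosition L M) → PDLPosition L M → Prop
  | start (s : PDLAssignment M) (hs : s ∈ X) : Play σ X ψ [] ⟨[], ψ, s, .eloise⟩
  | step (h : List (PDLPosition L M)) (p q : PDLPosition L M) (hp : Play σ X ψ h p)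
      (hq : q ∈ p.succ) (hσ : p.player = β → q ∈ σ.choice h p) : Play σ X ψ (p :: h) q

/-- The strategy is winning: player `β` wins every complete play in which `β` follows it. -/
def IsWinning [Nonempty M] [L.Structure M] (σ : PDLStrategy L M β)
    (X : Set (PDLAssignment M)) (ψ : PDLFormula L) : Prop :=
  ∀ h p, σ.Play X ψ h p → p.IsTerminal → p.WonBy β

/-- The strategy is uniform: for any two plays in which `β` follows it and which end at the same
instance of a dependence atom `=(ts, us)`, with assignments `s` and `s'` and with player `β`, if the
values of `ts` under `s` and `s'` are the same then so are the values of `us`. -/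
def IsUniform [Nonempty M] [L.Structure M] (σ : PDLStrategy L M β)
    (X : Set (PDLAssignment M)) (ψ : PDLFormula L) : Prop :=
  ∀ (h h' : List (PDLPosition L M)) (d : List Bool) (ts us : List (L.Term ℕ))
    (s s' : PDLAssignment M),
    σ.Play X ψ h ⟨d, .dep ts us, s, β⟩ → σ.Play X ψ h' ⟨d, .dep ts us, s', β⟩ →
    ts.map (fun t => t.realize s.val) = ts.map (fun t => t.realize s'.val) →
    us.map (fun t => t.realize s.val) = us.map (fun t => t.realize s'.val)

end PDLStrategy

/-- Paraconsistent satisfaction `(M, X) ⊨⁺ ψ`: Abelard has no uniform winning strategy in the semantic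
game for `ψ` on `M` that starts from the assignments in `X`. -/
def ParaSat {L : FirstOrder.Language.{u, v}} {M : Type w} [Nonempty M] [L.Structure M]
    (X : Set (PDLAssignment M)) (ψ : PDLFormula L) : Prop :=
  ¬ ∃ σ : PDLStrategy L M .abelard, σ.IsUniform X ψ ∧ σ.IsWinning X ψ

/-! ## Universal second-order sentences `Φ(R)` -/

/-- The signature whose only symbol is one `n`-ary relation symbol `R`. -/
def relVarLang (n : ℕ) : FirstOrder.Language.{0, 0} :=
  ⟨fun _ => Empty, fun k => PLift (n = k)⟩

/-- The interpretation of the symbol `R` by a given `n`-ary relation. -/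
@[reducible] def relVarStructure {M : Type w} {n : ℕ} (R : Set (Fin n → M)) : (relVarLang n).Structure M where
  funMap f := f.elim
  RelMap r a := (fun i : Fin n => a (Fin.cast r.down i)) ∈ R

/-- The signature of finitely many second-order variables: relation variables of the arities
`relAr i` and function variables of the arities `funAr j`. -/
def secondOrderVars {k l : ℕ} (relAr : Fin k → ℕ) (funAr : Fin l → ℕ) : FirstOrder.Language.{0, 0} :=
  ⟨fun m => {j : Fin l // funAr j = m}, fun m => {i : Fin k // relAr i = m}⟩

/-- A `Π¹₁` sentence `Φ(R)` over the signature `L`, where `R` is a new `n`-ary relation symbol: a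
first-order sentence `matrix`, in the signature `L`, the symbol `R` and finitely many second-order
variables, with all the second-order variables universally quantified in front. -/
structure Pi11Sentence (L : FirstOrder.Language.{u, v}) (n : ℕ) : Type (max u v) where
  {numRel : ℕ}
  {numFun : ℕ}
  relAr : Fin numRel → ℕ
  funAr : Fin numFun → ℕ
  matrix : ((L.sum (relVarLang n)).sum (secondOrderVars relAr funAr)).Sentence

/-- All occurrences in `φ` of the relation symbols selected by `S` are positive (`b = true`), or all
are negative (`b = false`). The antecedent of an implication reverses the sign, and `¬ φ` is
`φ → ⊥`. -/
def occursOnly {L : FirstOrder.Language.{u, v}} {α : Type w} (S : ∀ k, L.Relations k → Prop) :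
    Bool → ∀ {m : ℕ}, L.BoundedFormula α m → Prop
  | _, _, .falsum => True
  | _, _, .equal _ _ => True
  | b, _, .rel r _ => S _ r → b = true
  | b, _, .imp φ θ => occursOnly S (!b) φ ∧ occursOnly S b θ
  | b, _, .all φ => occursOnly S b φ

namespace Pi11Sentence

variable {L : FirstOrder.Language.{u, v}} {n : ℕ}

/-- `R` occurs only positively in `Φ(R)`. -/
def OnlyPositive (Φ : Pi11Sentence L n) : Prop :=
  occursOnly (fun k r => ∃ R : (relVarLang n).Relations k, r = Sum.inl (Sum.inr R)) true Φ.matrix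

/-- `M ⊨ Φ(R)`: the matrix is true in `M` for the given relation `R` and all interpretations of the
second-order variables by relations and functions on `M`. -/
def Realize (Φ : Pi11Sentence L n) (M : Type w) [L.Structure M] (R : Set (Fin n → M)) : Prop :=
  letI : (relVarLang n).Structure M := relVarStructure R
  ∀ _I : (secondOrderVars Φ.relAr Φ.funAr).Structure M, M ⊨ Φ.matrix

end Pi11Sentence

-- The formula is `ψ = ¬χ`, with `χ` in the syntax of dependence logic. After the initial swap of
-- roles Abelard plays `χ` as its verifier, so he has a uniform winning strategy exactly when the
-- team `X` satisfies `χ` in team semantics (`paraSat_iff_not_teamSat`). It remains to find `χ` that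
-- holds in `X` iff `X` is empty or `Φ(X(V))` fails.
--
-- Since `R` is positive in the matrix, `Φ(X(V))` fails iff some relation `R ⊇ X(V)` and some values
-- of the second-order variables falsify the matrix (`Pi11Sentence.not_realize_iff`). So `R` can
-- itself be quantified existentially, and the team enters only through the condition that every
-- tuple of `X(V)` lies in `R`, a condition on one assignment at a time.
--
-- This existential second-order statement is put in the form: there are functions `F` such that,
-- for all `a ∈ X(V)` and all tuples `y false`, `y true`, a quantifier-free condition holds on `a`,
-- the `y b` and the `F i (y b)`. Instead of Skolemizing a prenex form, one guesses the values of
-- all terms and the truth values of all formulas and imposes Tarski's clauses; each clause compares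
-- at most two tuples (`exists_holds_refutationMatrix`). Guessed relations are then coded by
-- functions (`realize_elimBits`), and the infinite supply of variables is cut down to those that
-- occur (`exists_pdlFormula_of_skolemForm`).
--
-- Dependence logic expresses the result (`teamSat_skolemForm`): quantify the `y b` universally and
-- the values existentially, and let dependence atoms say that the values are functions of `y b`
-- alone. These atoms do not mention the variables of `V`, so the same functions serve the whole
-- team. For the empty team the statement is vacuous, hence `χ` holds and `ψ` fails.

universe u' v'

/-! ## Winning sets of positions -/

section WinningSets

variable {L : FirstOrder.Language.{u, v}} {M : Type w}

/-- A set of positions in which Abelard can remain, in which he wins all finished plays, and which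
is uniform for him. -/
structure IsWinningSet [Nonempty M] [L.Structure M] (G : Set (PDLPosition L M)) : Prop where
  closed : ∀ p ∈ G, p.player = .eloise → p.succ ⊆ G
  move : ∀ p ∈ G, p.player = .abelard → ¬ p.IsTerminal → (p.succ ∩ G).Nonempty
  won : ∀ p ∈ G, p.IsTerminal → p.WonBy .abelard
  uniform : ∀ (d : List Bool) (ts us : List (L.Term ℕ)) (s s' : PDLAssignment M),
    ⟨d, .dep ts us, s, .abelard⟩ ∈ G → ⟨d, .dep ts us, s', .abelard⟩ ∈ G →
    ts.map (fun t => t.realize s.val) = ts.map (fun t => t.realize s'.val) →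
    us.map (fun t => t.realize s.val) = us.map (fun t => t.realize s'.val)

/-- A position where the game does not end has a next position. -/
theorem PDLPosition.succ_nonempty [Nonempty M] (p : PDLPosition L M) (hp : ¬ p.IsTerminal) :
    p.succ.Nonempty := by
  obtain ⟨d, ψ, s, α⟩ := p
  cases ψ with
  | rel R ts => exact absurd trivial hp
  | eq t₁ t₂ => exact absurd trivial hp
  | dep ts us => exact absurd trivial hp
  | neg ψ => exact ⟨_, rfl⟩
  | or ψ θ => exact ⟨_, Or.inl rfl⟩
  | ex x ψ => exact ⟨_, Classical.arbitrary M, rfl⟩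

/-- The history of a play is irrelevant: the positions reachable under a strategy form a winning
set, because uniformity already compares all plays. Conversely, nondeterminism allows the memoryless
strategy that offers every move staying in `G`. -/
theorem exists_strategy_iff_exists_isWinningSet [Nonempty M] [L.Structure M]
    (X : Set (PDLAssignment M)) (ψ : PDLFormula L) :
    (∃ σ : PDLStrategy L M .abelard, σ.IsUniform X ψ ∧ σ.IsWinning X ψ) ↔
      ∃ G : Set (PDLPosition L M), IsWinningSet G ∧ ∀ s ∈ X, ⟨[], ψ, s, .eloise⟩ ∈ G := by
  classical
  constructor
  · rintro ⟨σ, hu, hw⟩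
    refine ⟨{p | ∃ h, σ.Play X ψ h p}, ⟨?_, ?_, ?_, ?_⟩, fun s hs => ⟨[], .start s hs⟩⟩
    · rintro p ⟨h, hp⟩ hpl q hq
      exact ⟨_, .step h p q hp hq (fun h' => by rw [hpl] at h'; cases h')⟩
    · rintro p ⟨h, hp⟩ hpl ht
      obtain ⟨q, hq⟩ := σ.choice_nonempty h p hpl ht
      have hq' := σ.choice_subset h p hpl ht hq
      exact ⟨q, hq', _, .step h p q hp hq' fun _ => hq⟩
    · rintro p ⟨h, hp⟩ ht
      exact hw h p hp ht
    · rintro d ts us s s' ⟨h, hp⟩ ⟨h', hp'⟩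
      exact hu h h' d ts us s s' hp hp'
  · rintro ⟨G, hG, hX⟩
    let σ : PDLStrategy L M .abelard :=
      -- The second branch is never reached in a play from `X`; it only makes the choice total and
      -- nonempty.
      { choice := fun _ p => if (p.succ ∩ G).Nonempty then p.succ ∩ G else p.succ
        choice_subset := by
          intro _ p _ _
          split_ifs
          · exact Set.inter_subset_left
          · exact subset_rfl
        choice_nonempty := by
          intro _ p _ ht
          split_ifs with h
          · exact h
          · exact p.succ_nonempty ht }
    have key : ∀ h p, σ.Play X ψ h p → p ∈ G := by
      intro h p hp
      induction hp with
      | start s hs => exact hX s hs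
      | step h p q _ hq hσ ih =>
        rcases hpl : p.player with _ | _
        · exact hG.closed p ih hpl hq
        · have ht : ¬ p.IsTerminal := by
            obtain ⟨d, ψ, s, α⟩ := p
            intro ht
            cases ψ <;> first | exact hq | exact ht
          have h1 := hσ hpl
          have h2 := hG.move p ih hpl ht
          simp only [σ, if_pos h2] at h1
          exact h1.2
    exact ⟨σ, fun h h' d ts us s s' hp hp' => hG.uniform d ts us s s' (key _ _ hp) (key _ _ hp'),
      fun h p hp => hG.won p (key _ _ hp)⟩

end WinningSets

/-! ## Team semantics -/

section TeamSemantics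

variable {L : FirstOrder.Language.{u, v}} {M : Type w} [Nonempty M] [L.Structure M]

/-- The team semantics of dependence logic, for a subformula that is played by `α` and from the
point of view of Abelard. -/
def TeamSat : PDLFormula L → PDLPlayer → Set (PDLAssignment M) → Prop
  | .rel R ts, α, X => ∀ s ∈ X, (α = .abelard ↔
      FirstOrder.Language.Structure.RelMap R (fun i => (ts i).realize s.val))
  | .eq t₁ t₂, α, X => ∀ s ∈ X, (α = .abelard ↔ t₁.realize s.val = t₂.realize s.val)
  | .dep ts us, α, X => ∀ s ∈ X, α = .abelard ∧ ∀ s' ∈ X,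
      ts.map (fun t => t.realize s.val) = ts.map (fun t => t.realize s'.val) →
      us.map (fun t => t.realize s.val) = us.map (fun t => t.realize s'.val)
  | .neg ψ, α, X => TeamSat ψ α.opp X
  | .or ψ θ, .abelard, X => ∃ Y Z, X ⊆ Y ∪ Z ∧ TeamSat ψ .abelard Y ∧ TeamSat θ .abelard Z
  | .or ψ θ, .eloise, X => TeamSat ψ .eloise X ∧ TeamSat θ .eloise X
  | .ex x ψ, .abelard, X => ∃ Y, (∀ s ∈ X, ∃ m, Function.update s x (some m) ∈ Y) ∧
      TeamSat ψ .abelard Y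
  | .ex x ψ, .eloise, X => TeamSat ψ .eloise {t | ∃ s ∈ X, ∃ m, t = Function.update s x (some m)}

/-- At Abelard's own disjunctions and quantifiers, the witnessing team consists of all assignments
that `G` contains at the address of the chosen subformula. -/
theorem TeamSat.of_isWinningSet {G : Set (PDLPosition L M)} (hG : IsWinningSet G)
    (ψ : PDLFormula L) : ∀ (d : List Bool) (α : PDLPlayer) (X : Set (PDLAssignment M)),
      (∀ s ∈ X, ⟨d, ψ, s, α⟩ ∈ G) → TeamSat ψ α X := by
  induction ψ with
  | rel R ts => exact fun d α X h s hs => hG.won _ (h s hs) trivial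
  | eq t₁ t₂ => exact fun d α X h s hs => hG.won _ (h s hs) trivial
  | dep ts us =>
    intro d α X h s hs
    have hα : α = .abelard := hG.won _ (h s hs) trivial
    subst hα
    exact ⟨rfl, fun s' hs' => hG.uniform d ts us s s' (h s hs) (h s' hs')⟩
  | neg ψ ih =>
    intro d α X h
    refine ih (false :: d) _ _ fun s hs => ?_
    cases α with
    | eloise => exact hG.closed _ (h s hs) rfl rfl
    | abelard =>
      obtain ⟨q, hq, hqG⟩ := hG.move _ (h s hs) rfl id
      rwa [show q = _ from hq] at hqG
  | or ψ θ ih₁ ih₂ =>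
    intro d α X h
    cases α with
    | eloise =>
      exact ⟨ih₁ (false :: d) _ _ fun s hs => hG.closed _ (h s hs) rfl (Or.inl rfl),
        ih₂ (true :: d) _ _ fun s hs => hG.closed _ (h s hs) rfl (Or.inr rfl)⟩
    | abelard =>
      refine ⟨{s | (⟨false :: d, ψ, s, .abelard⟩ : PDLPosition L M) ∈ G},
        {s | (⟨true :: d, θ, s, .abelard⟩ : PDLPosition L M) ∈ G}, ?_,
        ih₁ (false :: d) _ _ fun _ hs => hs, ih₂ (true :: d) _ _ fun _ hs => hs⟩
      intro s hs
      obtain ⟨q, hq | hq, hqG⟩ := hG.move _ (h s hs) rfl id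
      · exact Or.inl (by rwa [hq] at hqG)
      · exact Or.inr (by rwa [show q = _ from hq] at hqG)
  | ex x ψ ih =>
    intro d α X h
    cases α with
    | eloise =>
      refine ih (false :: d) _ _ ?_
      rintro _ ⟨s, hs, m, rfl⟩
      exact hG.closed _ (h s hs) rfl ⟨m, rfl⟩
    | abelard =>
      refine ⟨{s | (⟨false :: d, ψ, s, .abelard⟩ : PDLPosition L M) ∈ G}, fun s hs => ?_,
        ih (false :: d) _ _ fun _ hs => hs⟩
      obtain ⟨q, ⟨m, hq⟩, hqG⟩ := hG.move _ (h s hs) rfl id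
      exact ⟨m, by rwa [hq] at hqG⟩

/-- Adding to a winning set positions with a non-atomic formula. -/
theorem IsWinningSet.union {G H : Set (PDLPosition L M)} (hG : IsWinningSet G)
    (hH : ∀ p ∈ H, ¬ p.IsTerminal)
    (h₁ : ∀ p ∈ H, p.player = .eloise → p.succ ⊆ G)
    (h₂ : ∀ p ∈ H, p.player = .abelard → (p.succ ∩ G).Nonempty) : IsWinningSet (G ∪ H) where
  closed p hp hpl := by
    rcases hp with hp | hp
    · exact (hG.closed p hp hpl).trans Set.subset_union_left
    · exact (h₁ p hp hpl).trans Set.subset_union_left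
  move p hp hpl ht := by
    rcases hp with hp | hp
    · exact (hG.move p hp hpl ht).mono (Set.inter_subset_inter_right _ Set.subset_union_left)
    · exact (h₂ p hp hpl).mono (Set.inter_subset_inter_right _ Set.subset_union_left)
  won p hp ht := by
    rcases hp with hp | hp
    · exact hG.won p hp ht
    · exact absurd ht (hH p hp)
  uniform d ts us s s' h h' := by
    rcases h with h | h
    · rcases h' with h' | h'
      · exact hG.uniform d ts us s s' h h'
      · exact absurd trivial (hH _ h')
    · exact absurd trivial (hH _ h)

/-- The union of two winning sets that live in disjoint parts of the syntax tree. -/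
theorem IsWinningSet.union_of_disjoint {G H : Set (PDLPosition L M)} (hG : IsWinningSet G)
    (hH : IsWinningSet H) (hGH : ∀ p ∈ G, ∀ q ∈ H, p.addr ≠ q.addr) : IsWinningSet (G ∪ H) where
  closed p hp hpl := by
    rcases hp with hp | hp
    · exact (hG.closed p hp hpl).trans Set.subset_union_left
    · exact (hH.closed p hp hpl).trans Set.subset_union_right
  move p hp hpl ht := by
    rcases hp with hp | hp
    · exact (hG.move p hp hpl ht).mono (Set.inter_subset_inter_right _ Set.subset_union_left)
    · exact (hH.move p hp hpl ht).mono (Set.inter_subset_inter_right _ Set.subset_union_right)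
  won p hp ht := by
    rcases hp with hp | hp
    · exact hG.won p hp ht
    · exact hH.won p hp ht
  uniform d ts us s s' h h' := by
    rcases h with h | h <;> rcases h' with h' | h'
    · exact hG.uniform d ts us s s' h h'
    · exact absurd (rfl : d = d) (hGH _ h _ h')
    · exact absurd (rfl : d = d) (hGH _ h' _ h)
    · exact hH.uniform d ts us s s' h h'

/-- Addresses are stored with the latest step first, so descendants of `d` have `d` as a suffix.
Carrying this through the induction keeps the winning sets of two disjuncts at disjoint addresses,
so uniformity never has to compare two occurrences of the same dependence atom. -/
theorem TeamSat.exists_isWinningSet (ψ : PDLFormula L) :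
    ∀ (d : List Bool) (α : PDLPlayer) (X : Set (PDLAssignment M)), TeamSat ψ α X →
      ∃ G : Set (PDLPosition L M), IsWinningSet G ∧ (∀ s ∈ X, ⟨d, ψ, s, α⟩ ∈ G) ∧
        ∀ p ∈ G, d <:+ p.addr := by
  have cons_ne : ∀ (d e f : List Bool), false :: d <:+ e → true :: d <:+ f → e ≠ f := by
    rintro d e f ⟨a, rfl⟩ ⟨b, rfl⟩ h
    have := (List.append_inj' h rfl).2
    simp at this
  induction ψ with
  | rel R ts =>
    intro d α X h
    refine ⟨{p | ∃ s ∈ X, p = ⟨d, .rel R ts, s, α⟩}, ⟨?_, ?_, ?_, ?_⟩, fun s hs => ⟨s, hs, rfl⟩, ?_⟩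
    · rintro _ ⟨s, hs, rfl⟩ _ q hq; cases hq
    · rintro _ ⟨s, hs, rfl⟩ _ ht; exact absurd trivial ht
    · rintro _ ⟨s, hs, rfl⟩ _; exact h s hs
    · rintro _ _ _ _ _ ⟨s, hs, h⟩; cases h
    · rintro _ ⟨s, hs, rfl⟩; exact List.suffix_rfl
  | eq t₁ t₂ =>
    intro d α X h
    refine ⟨{p | ∃ s ∈ X, p = ⟨d, .eq t₁ t₂, s, α⟩}, ⟨?_, ?_, ?_, ?_⟩, fun s hs => ⟨s, hs, rfl⟩, ?_⟩
    · rintro _ ⟨s, hs, rfl⟩ _ q hq; cases hq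
    · rintro _ ⟨s, hs, rfl⟩ _ ht; exact absurd trivial ht
    · rintro _ ⟨s, hs, rfl⟩ _; exact h s hs
    · rintro _ _ _ _ _ ⟨s, hs, h⟩; cases h
    · rintro _ ⟨s, hs, rfl⟩; exact List.suffix_rfl
  | dep ts us =>
    intro d α X h
    refine ⟨{p | ∃ s ∈ X, p = ⟨d, .dep ts us, s, α⟩}, ⟨?_, ?_, ?_, ?_⟩, fun s hs => ⟨s, hs, rfl⟩, ?_⟩
    · rintro _ ⟨s, hs, rfl⟩ _ q hq; cases hq
    · rintro _ ⟨s, hs, rfl⟩ _ ht; exact absurd trivial ht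
    · rintro _ ⟨s, hs, rfl⟩ _; exact (h s hs).1
    · rintro _ _ _ _ _ ⟨s, hs, e⟩ ⟨s', hs', e'⟩
      cases e; cases e'
      exact (h _ hs).2 _ hs'
    · rintro _ ⟨s, hs, rfl⟩; exact List.suffix_rfl
  | neg ψ ih =>
    intro d α X h
    obtain ⟨G, hG, hX, hd⟩ := ih (false :: d) _ _ h
    refine ⟨G ∪ {p | ∃ s ∈ X, p = ⟨d, .neg ψ, s, α⟩}, hG.union ?_ ?_ ?_,
      fun s hs => Or.inr ⟨s, hs, rfl⟩, ?_⟩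
    · rintro _ ⟨s, hs, rfl⟩; exact id
    · rintro _ ⟨s, hs, rfl⟩ _ q hq
      rw [show q = _ from hq]
      exact hX s hs
    · rintro _ ⟨s, hs, rfl⟩ _
      exact ⟨_, rfl, hX s hs⟩
    · rintro p (hp | ⟨s, hs, rfl⟩)
      · exact (List.suffix_cons _ _).trans (hd p hp)
      · exact List.suffix_rfl
  | or ψ θ ih₁ ih₂ =>
    intro d α X h
    cases α with
    | eloise =>
      obtain ⟨G, hG, hX, hd⟩ := ih₁ (false :: d) _ _ h.1
      obtain ⟨H, hH, hX', hd'⟩ := ih₂ (true :: d) _ _ h.2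
      refine ⟨G ∪ H ∪ {p | ∃ s ∈ X, p = ⟨d, .or ψ θ, s, .eloise⟩},
        (hG.union_of_disjoint hH fun p hp q hq => cons_ne d _ _ (hd p hp) (hd' q hq)).union ?_ ?_ ?_,
        fun s hs => Or.inr ⟨s, hs, rfl⟩, ?_⟩
      · rintro _ ⟨s, hs, rfl⟩; exact id
      · rintro _ ⟨s, hs, rfl⟩ _ q (hq | hq)
        · rw [hq]; exact Or.inl (hX s hs)
        · rw [show q = _ from hq]; exact Or.inr (hX' s hs)
      · rintro _ ⟨s, hs, rfl⟩ h; cases h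
      · rintro p ((hp | hp) | ⟨s, hs, rfl⟩)
        · exact (List.suffix_cons _ _).trans (hd p hp)
        · exact (List.suffix_cons _ _).trans (hd' p hp)
        · exact List.suffix_rfl
    | abelard =>
      obtain ⟨Y, Z, hYZ, h₁, h₂⟩ := h
      obtain ⟨G, hG, hX, hd⟩ := ih₁ (false :: d) _ _ h₁
      obtain ⟨H, hH, hX', hd'⟩ := ih₂ (true :: d) _ _ h₂
      refine ⟨G ∪ H ∪ {p | ∃ s ∈ X, p = ⟨d, .or ψ θ, s, .abelard⟩},
        (hG.union_of_disjoint hH fun p hp q hq => cons_ne d _ _ (hd p hp) (hd' q hq)).union ?_ ?_ ?_,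
        fun s hs => Or.inr ⟨s, hs, rfl⟩, ?_⟩
      · rintro _ ⟨s, hs, rfl⟩; exact id
      · rintro _ ⟨s, hs, rfl⟩ h; cases h
      · rintro _ ⟨s, hs, rfl⟩ _
        rcases hYZ hs with hs | hs
        · exact ⟨_, Or.inl rfl, Or.inl (hX s hs)⟩
        · exact ⟨_, Or.inr rfl, Or.inr (hX' s hs)⟩
      · rintro p ((hp | hp) | ⟨s, hs, rfl⟩)
        · exact (List.suffix_cons _ _).trans (hd p hp)
        · exact (List.suffix_cons _ _).trans (hd' p hp)
        · exact List.suffix_rfl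
  | ex x ψ ih =>
    intro d α X h
    cases α with
    | eloise =>
      obtain ⟨G, hG, hX, hd⟩ := ih (false :: d) _ _ h
      refine ⟨G ∪ {p | ∃ s ∈ X, p = ⟨d, .ex x ψ, s, .eloise⟩}, hG.union ?_ ?_ ?_,
        fun s hs => Or.inr ⟨s, hs, rfl⟩, ?_⟩
      · rintro _ ⟨s, hs, rfl⟩; exact id
      · rintro _ ⟨s, hs, rfl⟩ _ q ⟨m, hq⟩
        rw [hq]
        exact hX _ ⟨s, hs, m, rfl⟩
      · rintro _ ⟨s, hs, rfl⟩ h; cases h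
      · rintro p (hp | ⟨s, hs, rfl⟩)
        · exact (List.suffix_cons _ _).trans (hd p hp)
        · exact List.suffix_rfl
    | abelard =>
      obtain ⟨Y, hY, h⟩ := h
      obtain ⟨G, hG, hX, hd⟩ := ih (false :: d) _ _ h
      refine ⟨G ∪ {p | ∃ s ∈ X, p = ⟨d, .ex x ψ, s, .abelard⟩}, hG.union ?_ ?_ ?_,
        fun s hs => Or.inr ⟨s, hs, rfl⟩, ?_⟩
      · rintro _ ⟨s, hs, rfl⟩; exact id
      · rintro _ ⟨s, hs, rfl⟩ h; cases h
      · rintro _ ⟨s, hs, rfl⟩ _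
        obtain ⟨m, hm⟩ := hY s hs
        exact ⟨_, ⟨m, rfl⟩, hX _ hm⟩
      · rintro p (hp | ⟨s, hs, rfl⟩)
        · exact (List.suffix_cons _ _).trans (hd p hp)
        · exact List.suffix_rfl

/-- Paraconsistent satisfaction in terms of team semantics. -/
theorem paraSat_iff_not_teamSat (X : Set (PDLAssignment M)) (ψ : PDLFormula L) :
    ParaSat X ψ ↔ ¬ TeamSat ψ .eloise X := by
  rw [ParaSat, exists_strategy_iff_exists_isWinningSet]
  refine not_congr ⟨fun ⟨G, hG, hX⟩ => TeamSat.of_isWinningSet hG ψ [] _ X hX, fun h => ?_⟩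
  obtain ⟨G, hG, hX, -⟩ := TeamSat.exists_isWinningSet ψ [] _ _ h
  exact ⟨G, hG, hX⟩

end TeamSemantics

/-! ## Quantifier-free formulas -/

/-- Quantifier-free formulas over `L` with variables in `V` and with additional propositional
variables in `B`. -/
inductive QF (L : FirstOrder.Language.{u, v}) (V B : Type*)
  | fls : QF L V B
  | eq (t₁ t₂ : L.Term V) : QF L V B
  | rel {k : ℕ} (R : L.Relations k) (ts : Fin k → L.Term V) : QF L V B
  | bit (b : B) : QF L V B
  | imp (θ η : QF L V B) : QF L V B

namespace QF

variable {L : FirstOrder.Language.{u, v}} {V V' B B' : Type*} {M : Type w}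

def realize [L.Structure M] (val : V → M) (p : B → Prop) : QF L V B → Prop
  | fls => False
  | eq t₁ t₂ => t₁.realize val = t₂.realize val
  | rel R ts => FirstOrder.Language.Structure.RelMap R fun i => (ts i).realize val
  | bit b => p b
  | imp θ η => θ.realize val p → η.realize val p

def neg (θ : QF L V B) : QF L V B := .imp θ .fls

def and (θ η : QF L V B) : QF L V B := neg (.imp θ (neg η))

def or (θ η : QF L V B) : QF L V B := .imp (neg θ) η

def conj : List (QF L V B) → QF L V B
  | [] => neg .fls
  | θ :: l => and θ (conj l)

def disj : List (QF L V B) → QF L V B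
  | [] => .fls
  | θ :: l => or θ (disj l)

/-- Equality of two variables. -/
def eqVar (a b : V) : QF L V B := .eq (.var a) (.var b)

section Realize

variable [L.Structure M] {val : V → M} {p : B → Prop}

@[simp] theorem realize_imp (θ η : QF L V B) :
    (imp θ η).realize val p ↔ (θ.realize val p → η.realize val p) := Iff.rfl

@[simp] theorem realize_bit (b : B) : (bit b : QF L V B).realize val p ↔ p b := Iff.rfl

@[simp] theorem realize_eq (t₁ t₂ : L.Term V) :
    (eq t₁ t₂ : QF L V B).realize val p ↔ t₁.realize val = t₂.realize val := Iff.rfl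

@[simp] theorem realize_rel {k : ℕ} (R : L.Relations k) (ts : Fin k → L.Term V) :
    (rel R ts : QF L V B).realize val p ↔
      FirstOrder.Language.Structure.RelMap R fun i => (ts i).realize val := Iff.rfl

@[simp] theorem realize_eqVar (a b : V) :
    (eqVar a b : QF L V B).realize val p ↔ val a = val b := Iff.rfl

@[simp] theorem realize_neg (θ : QF L V B) : θ.neg.realize val p ↔ ¬ θ.realize val p := Iff.rfl

@[simp] theorem realize_and (θ η : QF L V B) :
    (and θ η).realize val p ↔ θ.realize val p ∧ η.realize val p := by
  simp [and]

@[simp] theorem realize_or (θ η : QF L V B) :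
    (or θ η).realize val p ↔ θ.realize val p ∨ η.realize val p := by
  simp only [or, realize_imp, realize_neg]; tauto

@[simp] theorem realize_conj (l : List (QF L V B)) :
    (conj l).realize val p ↔ ∀ θ ∈ l, θ.realize val p := by
  induction l with
  | nil => simp only [conj, realize_neg, List.not_mem_nil]; simp [realize]
  | cons θ l ih => simp [conj, ih]

@[simp] theorem realize_disj (l : List (QF L V B)) :
    (disj l).realize val p ↔ ∃ θ ∈ l, θ.realize val p := by
  induction l with
  | nil => simp [disj, realize]
  | cons θ l ih => simp [disj, ih]

end Realize

/-- Substitution of variables and of propositional variables. -/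
def subst (f : V → V') (g : B → QF L V' B') : QF L V B → QF L V' B'
  | fls => .fls
  | eq t₁ t₂ => .eq (t₁.relabel f) (t₂.relabel f)
  | rel R ts => .rel R fun i => (ts i).relabel f
  | bit b => g b
  | imp θ η => .imp (θ.subst f g) (η.subst f g)

theorem realize_subst [L.Structure M] (f : V → V') (g : B → QF L V' B') (θ : QF L V B)
    (val : V' → M) (p : B' → Prop) :
    (θ.subst f g).realize val p ↔ θ.realize (val ∘ f) fun b => (g b).realize val p := by
  induction θ with
  | fls => rfl
  | eq t₁ t₂ => simp [subst]
  | rel R ts => simp [subst]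
  | bit b => rfl
  | imp θ η ih₁ ih₂ => simp [subst, ih₁, ih₂]

/-- The finite set of the propositional variables of a formula. -/
def bits [DecidableEq B] : QF L V B → Finset B
  | fls => ∅
  | eq _ _ => ∅
  | rel _ _ => ∅
  | bit b => {b}
  | imp θ η => θ.bits ∪ η.bits

/-- The finite set of the variables of a formula. -/
def vars [DecidableEq V] : QF L V B → Finset V
  | fls => ∅
  | eq t₁ t₂ => t₁.varFinset ∪ t₂.varFinset
  | rel _ ts => Finset.univ.biUnion fun i => (ts i).varFinset
  | bit _ => ∅
  | imp θ η => θ.vars ∪ η.vars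

theorem _root_.FirstOrder.Language.Term.realize_congr_varFinset [DecidableEq V] [L.Structure M]
    (t : L.Term V) {val val' : V → M} (h : ∀ a ∈ t.varFinset, val a = val' a) :
    t.realize val = t.realize val' := by
  induction t with
  | var a => exact h a (by simp [FirstOrder.Language.Term.varFinset])
  | func f ts ih =>
    simp only [FirstOrder.Language.Term.realize]
    congr 1
    funext i
    refine ih i fun a ha => h a ?_
    simp only [FirstOrder.Language.Term.varFinset, Finset.mem_biUnion, Finset.mem_univ, true_and]
    exact ⟨i, ha⟩

theorem realize_congr [DecidableEq V] [DecidableEq B] [L.Structure M] (θ : QF L V B)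
    {val val' : V → M} {p p' : B → Prop} (h : ∀ a ∈ θ.vars, val a = val' a)
    (h' : ∀ b ∈ θ.bits, p b ↔ p' b) : θ.realize val p ↔ θ.realize val' p' := by
  induction θ with
  | fls => rfl
  | eq t₁ t₂ =>
    simp only [vars, Finset.mem_union] at h
    rw [realize_eq, realize_eq, t₁.realize_congr_varFinset fun a ha => h a (.inl ha),
      t₂.realize_congr_varFinset fun a ha => h a (.inr ha)]
  | rel R ts =>
    simp only [vars, Finset.mem_biUnion, Finset.mem_univ, true_and] at h
    rw [realize_rel, realize_rel]
    have : ∀ i, (ts i).realize val = (ts i).realize val' := fun i =>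
      (ts i).realize_congr_varFinset fun a ha => h a ⟨i, ha⟩
    simp only [this]
  | bit b => exact h' b (by simp [bits])
  | imp θ η ih₁ ih₂ =>
    simp only [vars, bits, Finset.mem_union] at h h'
    rw [realize_imp, realize_imp, ih₁ (fun a ha => h a (.inl ha)) fun b hb => h' b (.inl hb),
      ih₂ (fun a ha => h a (.inr ha)) fun b hb => h' b (.inr hb)]

/-- The translation to dependence logic. -/
def toPDL (e : V → ℕ) : QF L V Empty → PDLFormula L
  | fls => .neg (.dep [] [])
  | eq t₁ t₂ => .eq (t₁.relabel e) (t₂.relabel e)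
  | rel R ts => .rel R fun i => (ts i).relabel e
  | imp θ η => .or (.neg (θ.toPDL e)) (η.toPDL e)

/-- Formulas without proper dependence atoms are flat: the team condition can be checked at each
assignment separately. Falsum becomes a negated dependence atom between empty tuples, which is lost
by the player who holds it. -/
theorem teamSat_toPDL [Nonempty M] [L.Structure M] (e : V → ℕ) (θ : QF L V Empty)
    (α : PDLPlayer) (X : Set (PDLAssignment M)) :
    TeamSat (θ.toPDL e) α X ↔
      ∀ s ∈ X, (α = .abelard ↔ θ.realize (s.val ∘ e) Empty.elim) := by
  induction θ generalizing α X with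
  | fls => cases α <;> simp [toPDL, TeamSat, realize, PDLPlayer.opp]
  | eq t₁ t₂ => simp [toPDL, TeamSat]
  | rel R ts => simp [toPDL, TeamSat]
  | bit b => exact b.elim
  | imp θ η ih₁ ih₂ =>
    cases α with
    | eloise =>
      simp only [toPDL, TeamSat, PDLPlayer.opp, ih₁, ih₂, realize_imp]
      rw [← forall₂_and]
      refine forall₂_congr fun s hs => ?_
      simp
    | abelard =>
      simp only [toPDL, TeamSat, PDLPlayer.opp, ih₁, ih₂, realize_imp]
      constructor
      · rintro ⟨Y, Z, h, h₁, h₂⟩ s hs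
        rcases h hs with h | h
        · have := h₁ s h
          simp only [reduceCtorEq, false_iff] at this
          simp [this]
        · have := h₂ s h
          simp only [true_iff] at this
          simp [this]
      · intro h
        -- The disjuncts are flat, so each may receive every assignment that satisfies it, inside or
        -- outside of `X`.
        refine ⟨{s | ¬ θ.realize (s.val ∘ e) Empty.elim}, {s | η.realize (s.val ∘ e) Empty.elim},
          fun s hs => ?_, fun s hs => by simpa using hs, fun s hs => by simpa using hs⟩
        have := h s hs
        simp only [true_iff] at this
        by_cases h' : θ.realize (s.val ∘ e) Empty.elim
        · exact Or.inr (this h')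
        · exact Or.inl h'

theorem _root_.FirstOrder.Language.Term.mem_varFinset_relabel [DecidableEq V] [DecidableEq V']
    (f : V → V') (t : L.Term V) {a : V'} (h : a ∈ (t.relabel f).varFinset) : a ∈ Set.range f := by
  induction t with
  | var b =>
    simp only [FirstOrder.Language.Term.relabel, FirstOrder.Language.Term.varFinset,
      Finset.mem_singleton] at h
    exact ⟨b, h.symm⟩
  | func g ts ih =>
    simp only [FirstOrder.Language.Term.relabel, FirstOrder.Language.Term.varFinset,
      Finset.mem_biUnion, Finset.mem_univ, true_and] at h
    obtain ⟨i, hi⟩ := h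
    exact ih i hi

theorem free_toPDL (e : V → ℕ) (θ : QF L V Empty) : (θ.toPDL e).free ⊆ Set.range e := by
  classical
  induction θ with
  | fls => rintro a ⟨t, ht, -⟩; simp at ht
  | eq t₁ t₂ =>
    rintro a (h | h)
    · exact t₁.mem_varFinset_relabel e h
    · exact t₂.mem_varFinset_relabel e h
  | rel R ts =>
    rintro a ⟨i, h⟩
    exact (ts i).mem_varFinset_relabel e h
  | bit b => exact b.elim
  | imp θ η ih₁ ih₂ => exact Set.union_subset ih₁ ih₂

end QF

/-! ## Conjunctions and blocks of quantifiers -/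

namespace PDLFormula

variable {L : FirstOrder.Language.{u, v}} {M : Type w}

def and (ψ θ : PDLFormula L) : PDLFormula L := .neg (.or (.neg ψ) (.neg θ))

def conj (l : List (PDLFormula L)) : PDLFormula L := l.foldr and (.dep [] [])

def alls (l : List ℕ) (ψ : PDLFormula L) : PDLFormula L :=
  l.foldr (fun x φ => .neg (.ex x (.neg φ))) ψ

def exs (l : List ℕ) (ψ : PDLFormula L) : PDLFormula L := l.foldr .ex ψ

theorem free_and (ψ θ : PDLFormula L) : (ψ.and θ).free = ψ.free ∪ θ.free := rfl

theorem free_conj {l : List (PDLFormula L)} {A : Set ℕ} (h : ∀ ψ ∈ l, ψ.free ⊆ A) :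
    (conj l).free ⊆ A := by
  induction l with
  | nil => rintro a ⟨t, ht, -⟩; simp at ht
  | cons ψ l ih =>
    exact Set.union_subset (h ψ (by simp)) (ih fun θ hθ => h θ (by simp [hθ]))

theorem free_alls (l : List ℕ) (ψ : PDLFormula L) : (alls l ψ).free = ψ.free \ {x | x ∈ l} := by
  induction l with
  | nil => simp [alls]
  | cons x l ih =>
    change (alls l ψ).free \ {x} = _
    rw [ih]
    ext y
    simp only [Set.mem_sdiff, Set.mem_ofPred_eq, Set.mem_singleton_iff, List.mem_cons]
    tauto

theorem free_exs (l : List ℕ) (ψ : PDLFormula L) : (exs l ψ).free = ψ.free \ {x | x ∈ l} := by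
  induction l with
  | nil => simp [exs]
  | cons x l ih =>
    change (exs l ψ).free \ {x} = _
    rw [ih]
    ext y
    simp only [Set.mem_sdiff, Set.mem_ofPred_eq, Set.mem_singleton_iff, List.mem_cons]
    tauto

end PDLFormula

namespace PDLAssignment

variable {M : Type w}

/-- `t` differs from `s` only on the variables in `l`, and is defined on them. -/
def Variant (l : List ℕ) (s t : PDLAssignment M) : Prop :=
  (∀ x, x ∉ l → t x = s x) ∧ ∀ x ∈ l, t x ≠ none

theorem variant_cons {x : ℕ} {l : List ℕ} {s t : PDLAssignment M} :
    Variant (x :: l) s t ↔ ∃ m, Variant l (Function.update s x (some m)) t := by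
  constructor
  · rintro ⟨h₁, h₂⟩
    obtain ⟨m, hm⟩ := Option.ne_none_iff_exists'.1 (h₂ x (by simp))
    refine ⟨m, fun y hy => ?_, fun y hy => h₂ y (by simp [hy])⟩
    rcases eq_or_ne y x with rfl | hne
    · simp [hm]
    · rw [Function.update_of_ne hne]
      exact h₁ y (by simp [hne, hy])
  · rintro ⟨m, h₁, h₂⟩
    refine ⟨fun y hy => ?_, fun y hy => ?_⟩
    · simp only [List.mem_cons, not_or] at hy
      rw [h₁ y hy.2, Function.update_of_ne hy.1]
    · by_cases h : y ∈ l
      · exact h₂ y h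
      · have : y = x := by simpa [h] using hy
        rw [h₁ y h, this]
        simp

end PDLAssignment

section Blocks

open PDLFormula PDLAssignment

variable {L : FirstOrder.Language.{u, v}} {M : Type w} [Nonempty M] [L.Structure M]

theorem teamSat_and (ψ θ : PDLFormula L) (X : Set (PDLAssignment M)) :
    TeamSat (ψ.and θ) .abelard X ↔ TeamSat ψ .abelard X ∧ TeamSat θ .abelard X := Iff.rfl

theorem teamSat_conj (l : List (PDLFormula L)) (X : Set (PDLAssignment M)) :
    TeamSat (conj l) .abelard X ↔ ∀ ψ ∈ l, TeamSat ψ .abelard X := by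
  induction l with
  | nil => simp [conj, TeamSat]
  | cons ψ l ih =>
    rw [List.forall_mem_cons, ← ih]
    rfl

theorem teamSat_alls (l : List ℕ) (ψ : PDLFormula L) (X : Set (PDLAssignment M)) :
    TeamSat (alls l ψ) .abelard X ↔ TeamSat ψ .abelard {t | ∃ s ∈ X, Variant l s t} := by
  induction l generalizing X with
  | nil =>
    have : {t | ∃ s ∈ X, Variant [] s t} = X := by
      ext t
      simp only [Variant, List.not_mem_nil, not_false_eq_true, forall_const, IsEmpty.forall_iff,
        and_true, Set.mem_ofPred_eq, ← funext_iff]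
      simp
    rw [this]
    rfl
  | cons x l ih =>
    change TeamSat (alls l ψ) .abelard {t | ∃ s ∈ X, ∃ m, t = Function.update s x (some m)} ↔ _
    rw [ih]
    congr! 2
    ext t
    simp only [Set.mem_ofPred_eq, variant_cons]
    aesop

theorem teamSat_exs (l : List ℕ) (ψ : PDLFormula L) (X : Set (PDLAssignment M)) :
    TeamSat (exs l ψ) .abelard X ↔
      ∃ Y, (∀ s ∈ X, ∃ t ∈ Y, Variant l s t) ∧ TeamSat ψ .abelard Y := by
  induction l generalizing X with
  | nil =>
    simp only [exs, List.foldr_nil, Variant, List.not_mem_nil, not_false_eq_true, forall_const,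
        IsEmpty.forall_iff, and_true, ← funext_iff, exists_eq_right]
    refine ⟨fun h => ⟨X, fun s hs => hs, h⟩, fun ⟨Y, hXY, h⟩ => ?_⟩
    -- This is downward closure of team semantics: a winning set for `Y` also serves the subteam
    -- `X`.
    obtain ⟨G, hG, hY, -⟩ := TeamSat.exists_isWinningSet ψ [] _ _ h
    exact TeamSat.of_isWinningSet hG ψ [] _ X fun s hs => hY s (hXY s hs)
  | cons x l ih =>
    change (∃ Y, (∀ s ∈ X, ∃ m, Function.update s x (some m) ∈ Y) ∧
      TeamSat (exs l ψ) .abelard Y) ↔ _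
    simp only [ih, variant_cons]
    constructor
    · rintro ⟨Y, hXY, Z, hYZ, h⟩
      refine ⟨Z, fun s hs => ?_, h⟩
      obtain ⟨m, hm⟩ := hXY s hs
      obtain ⟨t, ht, hst⟩ := hYZ _ hm
      exact ⟨t, ht, m, hst⟩
    · rintro ⟨Z, hXZ, h⟩
      refine ⟨{s | ∃ t ∈ Z, Variant l s t}, fun s hs => ?_, Z, fun s hs => hs, h⟩
      obtain ⟨t, ht, m, hst⟩ := hXZ s hs
      exact ⟨m, t, ht, hst⟩

end Blocks

/-! ## Skolem normal forms in dependence logic -/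

/-- The variables of a Skolem normal form: the variables `x₁ … xₙ` of the team, the universally
quantified tuples `y false` and `y true`, indexed by `κ`, and the values `F i (y b)`, `i : ι`, of the
Skolem functions at these tuples. -/
abbrev SkolemVar (n : ℕ) (κ ι : Type*) := Fin n ⊕ (Bool × κ) ⊕ (Bool × ι)

namespace SkolemVar

variable {n : ℕ} {κ ι : Type*} {M : Type w}

/-- The component of the tuple `y b`. -/
abbrev tup (n : ℕ) (ι : Type*) (b : Bool) (k : κ) : SkolemVar n κ ι := .inr (.inl (b, k))

/-- The value `F i (y b)`. -/
abbrev app (n : ℕ) (κ : Type*) (b : Bool) (i : ι) : SkolemVar n κ ι := .inr (.inr (b, i))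

def val (a : Fin n → M) (y : Bool → κ → M) (F : ι → (κ → M) → M) : SkolemVar n κ ι → M :=
  Sum.elim a (Sum.elim (fun q => y q.1 q.2) fun q => F q.2 (y q.1))

@[simp] theorem val_inl (a : Fin n → M) (y : Bool → κ → M) (F : ι → (κ → M) → M) (j : Fin n) :
    val a y F (.inl j) = a j := rfl

@[simp] theorem val_tup (a : Fin n → M) (y : Bool → κ → M) (F : ι → (κ → M) → M) (b : Bool)
    (k : κ) : val a y F (.inr (.inl (b, k))) = y b k := rfl

@[simp] theorem val_app (a : Fin n → M) (y : Bool → κ → M) (F : ι → (κ → M) → M) (b : Bool)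
    (i : ι) : val a y F (.inr (.inr (b, i))) = F i (y b) := rfl

theorem exists_injective_extend [Finite κ] [Finite ι] {x : Fin n → ℕ}
    (hx : Function.Injective x) :
    ∃ e : SkolemVar n κ ι → ℕ, Function.Injective e ∧ ∀ j, e (.inl j) = x j := by
  obtain ⟨N, ⟨g⟩⟩ := Finite.exists_equiv_fin ((Bool × κ) ⊕ (Bool × ι))
  have hle : ∀ j, x j ≤ ∑ i, x i := fun j =>
    Finset.single_le_sum (f := x) (fun _ _ => Nat.zero_le _) (Finset.mem_univ j)
  -- The sum of all `x i` bounds each `x j`, so numbers beyond it are fresh.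
  refine ⟨Sum.elim x fun q => (∑ i, x i) + 1 + g q, ?_, fun _ => rfl⟩
  refine hx.sumElim (fun p q h => ?_) fun j q h => ?_
  · have : (g p : ℕ) = g q := by simpa using h
    exact g.injective (Fin.ext this)
  · have := hle j
    omega

end SkolemVar

section SkolemForm

open PDLFormula PDLAssignment SkolemVar

variable {L : FirstOrder.Language.{u, v}} {n : ℕ} {κ ι : Type*} [Fintype κ]

/-- If the tuples `y false` and `y true` are equal, so are the values of the Skolem functions. -/
noncomputable def coherence (L : FirstOrder.Language.{u, v}) (n : ℕ) (κ ι : Type*) [Fintype κ]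
    [Fintype ι] : QF L (SkolemVar n κ ι) Empty :=
  .imp (.conj ((Finset.univ : Finset κ).toList.map fun k =>
      .eqVar (tup n ι false k) (tup n ι true k)))
    (.conj ((Finset.univ : Finset ι).toList.map fun i =>
      .eqVar (app n κ false i) (app n κ true i)))

theorem realize_coherence [Fintype ι] {M : Type w} [L.Structure M] (val : SkolemVar n κ ι → M)
    (p : Empty → Prop) : (coherence L n κ ι).realize val p ↔
      ((∀ k, val (tup n ι false k) = val (tup n ι true k)) →
        ∀ i, val (app n κ false i) = val (app n κ true i)) := by
  simp [coherence]

/-- The dependence atom that says that `F i (y b)` is a function of `y b`. -/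
noncomputable def skolemDep (L : FirstOrder.Language.{u, v}) (e : SkolemVar n κ ι → ℕ) (b : Bool)
    (i : ι) : PDLFormula L :=
  .dep ((Finset.univ : Finset κ).toList.map fun k => .var (e (tup n ι b k)))
    [.var (e (app n κ b i))]

theorem teamSat_skolemDep {M : Type w} [Nonempty M] [L.Structure M] (e : SkolemVar n κ ι → ℕ)
    (b : Bool) (i : ι) (X : Set (PDLAssignment M)) :
    TeamSat (skolemDep L e b i) .abelard X ↔ ∀ s ∈ X, ∀ s' ∈ X,
      (∀ k, s.val (e (tup n ι b k)) = s'.val (e (tup n ι b k))) →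
        s.val (e (app n κ b i)) = s'.val (e (app n κ b i)) := by
  simp [skolemDep, TeamSat, FirstOrder.Language.Term.realize]

variable [Fintype ι]

/-- The dependence logic formula of a Skolem normal form with the matrix `θ`. -/
noncomputable def skolemForm (e : SkolemVar n κ ι → ℕ) (θ : QF L (SkolemVar n κ ι) Empty) :
    PDLFormula L :=
  alls ((Finset.univ : Finset (Bool × κ)).toList.map fun q => e (.inr (.inl q)))
    (exs ((Finset.univ : Finset (Bool × ι)).toList.map fun q => e (.inr (.inr q)))
      ((conj ((Finset.univ : Finset (Bool × ι)).toList.map fun q => skolemDep L e q.1 q.2)).and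
        ((QF.and (coherence L n κ ι) θ).toPDL e)))

theorem free_skolemForm {x : Fin n → ℕ} (e : SkolemVar n κ ι → ℕ) (hx : ∀ j, e (.inl j) = x j)
    (θ : QF L (SkolemVar n κ ι) Empty) : (skolemForm e θ).free ⊆ Set.range x := by
  have h : (skolemForm e θ).free ⊆ Set.range e \ ({y | ∃ q, e (.inr (.inr q)) = y} ∪
      {y | ∃ q, e (.inr (.inl q)) = y}) := by
    rw [skolemForm, free_alls, free_exs]
    simp only [List.mem_map, Finset.mem_toList, Finset.mem_univ, true_and]
    rw [sdiff_sdiff]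
    refine Set.sdiff_subset_sdiff_left ?_
    rw [free_and]
    refine Set.union_subset (free_conj ?_) (QF.free_toPDL _ _)
    simp only [List.mem_map, Finset.mem_toList, Finset.mem_univ, true_and]
    rintro _ ⟨q, rfl⟩ y ⟨t, ht, hy⟩
    simp only [List.mem_map, Finset.mem_toList, Finset.mem_univ, true_and,
      List.mem_singleton] at ht
    rcases ht with ⟨k, rfl⟩ | rfl
    · exact ⟨_, (by simpa [FirstOrder.Language.Term.varFinset] using hy : y = _).symm⟩
    · exact ⟨_, (by simpa [FirstOrder.Language.Term.varFinset] using hy : y = _).symm⟩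
  intro y hy
  obtain ⟨⟨j | q | q, rfl⟩, hy'⟩ := h hy
  · exact ⟨j, (hx j).symm⟩
  · exact absurd (Or.inr ⟨q, rfl⟩) hy'
  · exact absurd (Or.inl ⟨q, rfl⟩) hy'

theorem PDLAssignment.val_of_eq_some {M : Type w} [Nonempty M] {s : PDLAssignment M} {x : ℕ}
    {m : M} (h : s x = some m) : s.val x = m := by
  simp [PDLAssignment.val, h]

theorem PDLAssignment.val_congr {M : Type w} [Nonempty M] {s t : PDLAssignment M} {x : ℕ}
    (h : s x = t x) : s.val x = t.val x := by
  simp [PDLAssignment.val, h]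

/-- On the extended team the dependence atoms make each value variable a function of its tuple, with
no dependence on the variables `x`. They give one function for each of the two copies `false` and
`true`; `coherence` forces the two to agree. -/
theorem teamSat_skolemForm {x : Fin n → ℕ} (e : SkolemVar n κ ι → ℕ)
    (he : Function.Injective e) (hx : ∀ j, e (.inl j) = x j)
    (θ : QF L (SkolemVar n κ ι) Empty) {M : Type w} [Nonempty M] [L.Structure M]
    (X : Set (PDLAssignment M)) :
    TeamSat (skolemForm e θ) .abelard X ↔ ∃ F : ι → (κ → M) → M, ∀ s ∈ X, ∀ y : Bool → κ → M,
      θ.realize (SkolemVar.val (fun j => s.val (x j)) y F) Empty.elim := by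
  classical
  rw [skolemForm, teamSat_alls, teamSat_exs]
  simp only [teamSat_and, teamSat_conj, List.forall_mem_map, Finset.mem_toList, Finset.mem_univ,
    true_implies, QF.teamSat_toPDL, Prod.forall, teamSat_skolemDep, true_iff, QF.realize_and,
    realize_coherence, Set.mem_ofPred_eq, Function.comp_apply]
  constructor
  · rintro ⟨Y, hXY, hdep, hθ⟩
    -- The functions are read off from the copy `false` alone; tuples that do not occur get an
    -- arbitrary value.
    have hF : ∀ (i : ι) (q : κ → M), ∃ m, ∀ t ∈ Y, (∀ k, t.val (e (tup n ι false k)) = q k) →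
        t.val (e (app n κ false i)) = m := by
      intro i q
      by_cases h : ∃ t ∈ Y, ∀ k, t.val (e (tup n ι false k)) = q k
      · obtain ⟨t, ht, hq⟩ := h
        exact ⟨_, fun t' ht' hq' => hdep _ i t' ht' t ht fun k => by rw [hq, hq']⟩
      · exact ⟨Classical.arbitrary M, fun t ht hq => absurd ⟨t, ht, hq⟩ h⟩
    choose F hF using hF
    have hext : ∀ s ∈ X, ∀ y : Bool → κ → M, ∃ t ∈ Y, (∀ j, t.val (x j) = s.val (x j)) ∧
        ∀ b k, t.val (e (tup n ι b k)) = y b k := by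
      intro s hs y
      let t : PDLAssignment M := fun v =>
        if h : ∃ q, e (.inr (.inl q)) = v then some (y h.choose.1 h.choose.2) else s v
      have htup : ∀ q, t (e (.inr (.inl q))) = some (y q.1 q.2) := by
        intro q
        have h : ∃ q', e (.inr (.inl q')) = e (.inr (.inl q)) := ⟨q, rfl⟩
        have hq : h.choose = q := by simpa using he h.choose_spec
        simp only [t, dif_pos h, hq]
      have hoff : ∀ v, (¬ ∃ q, e (.inr (.inl q)) = v) → t v = s v := fun v h => dif_neg h
      obtain ⟨t', ht', h₁, -⟩ := hXY t ⟨s, hs, fun v hv => hoff v (by simpa using hv), by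
        simp only [List.forall_mem_map, htup]; simp⟩
      refine ⟨t', ht', fun j => val_congr ?_, fun b k => val_of_eq_some ?_⟩
      · rw [h₁, hoff]
        · rintro ⟨q, hq⟩
          rw [← hx] at hq
          simpa using he hq
        · simp only [List.mem_map, Finset.mem_toList, Finset.mem_univ, true_and, not_exists]
          intro q hq
          rw [← hx] at hq
          simpa using he hq
      · rw [h₁, htup]
        simp only [List.mem_map, Finset.mem_toList, Finset.mem_univ, true_and, not_exists]
        intro q hq
        simpa using he hq
    refine ⟨F, fun s hs y => ?_⟩
    obtain ⟨t, ht, hxt, hyt⟩ := hext s hs y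
    have hval : t.val ∘ e = SkolemVar.val (fun j => s.val (x j)) y F := by
      funext c
      obtain j | ⟨b, k⟩ | ⟨b, i⟩ := c
      · simp [hx, hxt]
      · exact hyt b k
      · cases b with
        | false => exact hF i _ t ht (hyt false)
        | true =>
          -- To compare the copy `true` with `F`, pass through an assignment where both tuples equal
          -- `y true`: coherence applies there, and the dependence atom of the copy `true` carries
          -- the value back to `t`.
          obtain ⟨t', ht', -, hyt'⟩ := hext s hs fun _ => y true
          have h₁ := (hθ t' ht').1 (fun k => by rw [hyt', hyt']) i
          have h₂ := hdep true i t ht t' ht' fun k => by rw [hyt, hyt']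
          exact h₂.trans (h₁.symm.trans (hF i _ t' ht' (hyt' false)))
    rw [← hval]
    exact (hθ t ht).2
  · rintro ⟨F, hF⟩
    refine ⟨{t | ∃ s ∈ X, ∃ y, t.val ∘ e = SkolemVar.val (fun j => s.val (x j)) y F}, ?_, ?_, ?_⟩
    · rintro t ⟨s, hs, hst, -⟩
      let y : Bool → κ → M := fun b k => t.val (e (tup n ι b k))
      let t' : PDLAssignment M := fun v =>
        if h : ∃ q, e (.inr (.inr q)) = v then some (F h.choose.2 (y h.choose.1)) else t v
      have happ : ∀ q, t' (e (.inr (.inr q))) = some (F q.2 (y q.1)) := by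
        intro q
        have h : ∃ q', e (.inr (.inr q')) = e (.inr (.inr q)) := ⟨q, rfl⟩
        have hq : h.choose = q := by simpa using he h.choose_spec
        simp only [t', dif_pos h, hq]
      have hoff : ∀ v, (¬ ∃ q, e (.inr (.inr q)) = v) → t' v = t v := fun v h => dif_neg h
      refine ⟨t', ⟨s, hs, y, ?_⟩, fun v hv => hoff v (by simpa using hv), by
        simp only [List.forall_mem_map, happ]; simp⟩
      funext c
      obtain j | ⟨b, k⟩ | ⟨b, i⟩ := c
      · change t'.val (e (.inl j)) = s.val (x j)
        rw [← hx]
        refine val_congr ?_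
        rw [hoff, hst]
        · simp only [List.mem_map, Finset.mem_toList, Finset.mem_univ, true_and, not_exists]
          intro q hq
          simpa using he hq
        · rintro ⟨q, hq⟩
          simpa using he hq
      · refine val_congr (s := t') (hoff _ ?_)
        rintro ⟨q, hq⟩
        simpa using he hq
      · exact val_of_eq_some (s := t') (happ (b, i))
    · rintro b i t ⟨s, hs, y, hst⟩ t' ⟨s', hs', y', hst'⟩ h
      have h₁ : ∀ c, t.val (e c) = _ := congrFun hst
      have h₂ : ∀ c, t'.val (e c) = _ := congrFun hst'
      simp only [h₁, h₂, val_tup, val_app] at h ⊢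
      rw [funext h]
    · rintro t ⟨s, hs, y, hst⟩
      have h₁ : ∀ c, t.val (e c) = _ := congrFun hst
      simp only [h₁, hst, val_tup, val_app]
      exact ⟨fun h i => by rw [funext h], hF s hs y⟩

end SkolemForm

/-! ## Skolem normal forms with infinitely many variables and with relation variables -/

section Reductions

open SkolemVar

variable {L : FirstOrder.Language.{u, v}} {n : ℕ} {ι κ : Type*}

/-- A formula mentions only finitely many tuple components and function indices. Components are
reduced modulo `K + 1`, which fixes all those that occur, and all function indices outside `S` are
sent to the dummy index `none`. -/
theorem exists_pdlFormula_of_skolemForm {x : Fin n → ℕ} (hx : Function.Injective x)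
    (θ : QF L (SkolemVar n ℕ ι) Empty) :
    ∃ χ : PDLFormula L, χ.free ⊆ Set.range x ∧
      ∀ (M : Type w) [Nonempty M] [L.Structure M] (X : Set (PDLAssignment M)),
        TeamSat χ .abelard X ↔ ∃ F : ι → (ℕ → M) → M, ∀ s ∈ X, ∀ y : Bool → ℕ → M,
          θ.realize (SkolemVar.val (fun j => s.val (x j)) y F) Empty.elim := by
  classical
  let S : Finset ι := θ.vars.biUnion fun
    | .inr (.inr q) => {q.2}
    | _ => ∅
  let K : ℕ := θ.vars.sup fun
    | .inr (.inl q) => q.2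
    | _ => 0
  have hS : ∀ b i, (.inr (.inr (b, i)) : SkolemVar n ℕ ι) ∈ θ.vars → i ∈ S := fun b i h =>
    Finset.mem_biUnion.2 ⟨_, h, Finset.mem_singleton_self _⟩
  have hK : ∀ b k, (.inr (.inl (b, k)) : SkolemVar n ℕ ι) ∈ θ.vars → k ≤ K := fun b k h =>
    Finset.le_sup (f := fun c : SkolemVar n ℕ ι => match c with
      | .inr (.inl q) => q.2
      | _ => 0) h
  let c : ι → Option S := fun i => if h : i ∈ S then some ⟨i, h⟩ else none
  have hc : ∀ i (h : i ∈ S), c i = some ⟨i, h⟩ := fun i h => dif_pos h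
  let ρ : SkolemVar n ℕ ι → SkolemVar n (Fin (K + 1)) (Option S) :=
    Sum.map id (Sum.map (Prod.map id fun k => Fin.ofNat (K + 1) k) (Prod.map id c))
  obtain ⟨e, he, hex⟩ := exists_injective_extend (κ := Fin (K + 1)) (ι := Option S) hx
  refine ⟨skolemForm e (θ.subst ρ Empty.elim), free_skolemForm e hex _, fun M _ _ X => ?_⟩
  rw [teamSat_skolemForm e he hex]
  constructor
  · rintro ⟨F, hF⟩
    refine ⟨fun i y => F (c i) fun k => y k, fun s hs y => ?_⟩
    have h := hF s hs fun b k => y b k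
    rw [QF.realize_subst] at h
    refine (QF.realize_congr θ (fun a ha => ?_) fun b => b.elim).1 h
    obtain j | ⟨b, k⟩ | ⟨b, i⟩ := a
    · rfl
    · have := hK b k ha
      change y b (k % (K + 1)) = y b k
      rw [Nat.mod_eq_of_lt (by omega)]
    · rfl
  · rintro ⟨F, hF⟩
    -- A finite tuple is extended periodically to an infinite one, in agreement with the reduction
    -- modulo `K + 1` in `ρ`.
    refine ⟨fun i q => i.elim (Classical.arbitrary M) fun i => F i fun k => q (Fin.ofNat (K + 1) k),
      fun s hs y => ?_⟩
    have h := hF s hs fun b k => y b (Fin.ofNat (K + 1) k)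
    rw [QF.realize_subst]
    refine (QF.realize_congr θ (fun a ha => ?_) fun b => b.elim).1 h
    obtain j | ⟨b, k⟩ | ⟨b, i⟩ := a
    · rfl
    · rfl
    · simp [ρ, hc i (hS b i ha)]

open Classical in
/-- Relation variables are replaced by function variables: a relation holds at a tuple if its function
has there the same value as a reference function. Since this needs two distinct elements, a model with
one element is treated by a disjunction over all the truth values. -/
noncomputable def elimBits (θ : QF L (SkolemVar n ℕ ι) (Bool × κ)) :
    QF L (SkolemVar n ℕ (ι ⊕ κ ⊕ Bool)) Empty :=
  let f : SkolemVar n ℕ ι → SkolemVar n ℕ (ι ⊕ κ ⊕ Bool) :=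
    Sum.map id (Sum.map id (Prod.map id Sum.inl))
  let u := app n ℕ false (.inr (.inr false))
  let v := app n ℕ false (.inr (.inr true))
  .or (.and (.neg (.eqVar u v)) (θ.subst f fun q =>
      .eqVar (app n ℕ q.1 (.inr (.inl q.2))) (app n ℕ q.1 (.inr (.inr false)))))
    (.and (.eqVar u v) (.and (.eqVar (tup n _ false 0) (tup n _ true 0))
      (.disj ((θ.bits.image Prod.snd).powerset.toList.map fun A =>
        θ.subst f fun q => if q.2 ∈ A then .neg .fls else .fls))))

/-- With two distinct elements, a relation is the set where its function agrees with the reference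
function; the second reference function, `v`, certifies that there are two elements. The equation
between the components `0` of the two tuples keeps the other disjunct from being used throughout a
model with more than one element. -/
theorem realize_elimBits (θ : QF L (SkolemVar n ℕ ι) (Bool × κ)) {M : Type w} [Nonempty M]
    [L.Structure M] (A : Set (Fin n → M)) :
    (∃ F : ι ⊕ κ ⊕ Bool → (ℕ → M) → M, ∀ a ∈ A, ∀ y : Bool → ℕ → M,
        (elimBits θ).realize (SkolemVar.val a y F) Empty.elim) ↔
      ∃ (F : ι → (ℕ → M) → M) (T : κ → (ℕ → M) → Prop), ∀ a ∈ A, ∀ y : Bool → ℕ → M,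
        θ.realize (SkolemVar.val a y F) fun q => T q.2 (y q.1) := by
  classical
  have hf : ∀ (F : ι ⊕ κ ⊕ Bool → (ℕ → M) → M) (a : Fin n → M) (y : Bool → ℕ → M),
      SkolemVar.val a y F ∘ Sum.map id (Sum.map id (Prod.map id Sum.inl)) =
        SkolemVar.val a y fun i => F (.inl i) := by
    intro F a y
    funext c
    obtain j | ⟨b, k⟩ | ⟨b, i⟩ := c <;> rfl
  simp only [elimBits, QF.realize_or, QF.realize_and, QF.realize_neg, QF.realize_eqVar,
    QF.realize_subst, hf, val_app, val_tup, QF.realize_disj, List.mem_map, Finset.mem_toList,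
    Finset.mem_powerset, exists_exists_and_eq_and]
  have hbit : ∀ (B : Finset κ) (j : κ) (val : SkolemVar n ℕ (ι ⊕ κ ⊕ Bool) → M),
      QF.realize val Empty.elim (if j ∈ B then QF.neg .fls else .fls : QF L _ Empty) ↔ j ∈ B := by
    intro B j val
    split_ifs with h <;> simp [h, QF.realize]
  simp only [hbit]
  rcases subsingleton_or_nontrivial M with hM | hM
  · constructor
    · rintro ⟨F, hF⟩
      rcases A.eq_empty_or_nonempty with rfl | ⟨a, ha⟩
      · exact ⟨fun i => F (.inl i), fun _ _ => True, by simp⟩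
      · obtain ⟨h, -⟩ | ⟨-, -, B, -, hB⟩ := hF a ha fun _ _ => Classical.arbitrary M
        · exact absurd (Subsingleton.elim _ _) h
        · refine ⟨fun i => F (.inl i), fun j _ => j ∈ B, fun a' _ y => ?_⟩
          -- There is only one valuation, so the set `B` found at one instance works at all of them.
          rwa [Subsingleton.elim (SkolemVar.val a' y _) _]
    · rintro ⟨F, T, h⟩
      refine ⟨Sum.elim F fun _ _ => Classical.arbitrary M, fun a ha y =>
        Or.inr ⟨Subsingleton.elim _ _, Subsingleton.elim _ _,
          (θ.bits.image Prod.snd).filter fun j => T j (y false), Finset.filter_subset _ _, ?_⟩⟩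
      refine (QF.realize_congr θ (fun _ _ => rfl) fun q hq => ?_).1 (h a ha y)
      rw [Subsingleton.elim (y q.1) (y false), Finset.mem_filter]
      exact (and_iff_right (Finset.mem_image_of_mem _ hq)).symm
  · obtain ⟨c, d, hcd⟩ := exists_pair_ne M
    constructor
    · rintro ⟨F, hF⟩
      refine ⟨fun i => F (.inl i),
        fun j y => F (.inr (.inl j)) y = F (.inr (.inr false)) y, fun a ha y => ?_⟩
      -- The reference values depend on `y false` only, so `y true` may be changed to differ from `y
      -- false` at the component `0`, which rules out the second disjunct.
      have hne : F (.inr (.inr false)) (y false) ≠ F (.inr (.inr true)) (y false) := by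
        obtain ⟨m, hm⟩ := exists_ne (y false 0)
        rcases hF a ha (fun b => if b then fun _ => m else y false) with h | h
        · exact h.1
        · exact absurd h.2.1.symm (by simpa using hm)
      rcases hF a ha y with h | h
      · exact h.2
      · exact absurd h.1 hne
    · rintro ⟨F, T, h⟩
      refine ⟨Sum.elim F (Sum.elim (fun j y => if T j y then c else d)
        fun b _ => if b then d else c), fun a ha y => Or.inl ⟨by simpa using hcd, ?_⟩⟩
      refine (QF.realize_congr θ (fun _ _ => rfl) fun q hq => ?_).1 (h a ha y)
      by_cases hq' : T q.2 (y q.1) <;> simp [hq', hcd.symm]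

end Reductions

/-! ## Skolem normal forms of existential second-order sentences -/

/-- A partial map from the symbols of `L'` to those of `L`. The symbols without a value are regarded as
second-order variables. -/
structure SymbolMap (L' : FirstOrder.Language.{u', v'}) (L : FirstOrder.Language.{u, v}) where
  onFun : ∀ {k : ℕ}, L'.Functions k → Option (L.Functions k)
  onRel : ∀ {k : ℕ}, L'.Relations k → Option (L.Relations k)

/-- The structure `S` interprets the symbols with a value as the corresponding symbols of `L`. -/
structure SymbolMap.Compatible {L' : FirstOrder.Language.{u', v'}} {L : FirstOrder.Language.{u, v}}
    (E : SymbolMap L' L) {M : Type w} [L.Structure M] (S : L'.Structure M) : Prop where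
  funMap_eq : ∀ {k : ℕ} (f : L'.Functions k) (g : L.Functions k), E.onFun f = some g →
    ∀ a : Fin k → M, S.funMap f a = FirstOrder.Language.Structure.funMap g a
  relMap_iff : ∀ {k : ℕ} (r : L'.Relations k) (g : L.Relations k), E.onRel r = some g →
    ∀ a : Fin k → M, S.RelMap r a ↔ FirstOrder.Language.Structure.RelMap g a

/-- The function variables of the Skolem normal form: the values of terms and of function symbols, and
counterexamples to universal formulas. -/
inductive SkolemFun (L' : FirstOrder.Language.{u', v'})
  | term {m : ℕ} (t : L'.Term (Empty ⊕ Fin m))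
  | symb {k : ℕ} (f : L'.Functions k)
  | cex {m : ℕ} (φ : L'.BoundedFormula Empty (m + 1))

/-- The relation variables of the Skolem normal form: the truth values of formulas and of relation
symbols. -/
inductive SkolemRel (L' : FirstOrder.Language.{u', v'})
  | form {m : ℕ} (φ : L'.BoundedFormula Empty m)
  | symb {k : ℕ} (r : L'.Relations k)

section TruthAxioms

open FirstOrder Language SkolemVar

variable {L' : FirstOrder.Language.{u', v'}} {L : FirstOrder.Language.{u, v}}

/-- Matrices of Skolem normal forms. -/
abbrev SkolemMatrix (L' : FirstOrder.Language.{u', v'}) (L : FirstOrder.Language.{u, v}) (n : ℕ) :=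
  QF L (SkolemVar n ℕ (SkolemFun L')) (Bool × SkolemRel L')

/-- The matrix `θ` holds for the parameters `a`, the functions `F`, the relations `T` and the two
tuples `y`. -/
def SkolemMatrix.Holds {n : ℕ} {M : Type w} [L.Structure M] (θ : SkolemMatrix L' L n)
    (a : Fin n → M) (F : SkolemFun L' → (ℕ → M) → M) (T : SkolemRel L' → (ℕ → M) → Prop)
    (y : Bool → ℕ → M) : Prop :=
  θ.realize (SkolemVar.val a y F) fun q => T q.2 (y q.1)

namespace QF

variable {V B : Type*} {M : Type w} [L.Structure M]

def iff (θ η : QF L V B) : QF L V B := and (imp θ η) (imp η θ)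

@[simp] theorem realize_iff (θ η : QF L V B) (val : V → M) (p : B → Prop) :
    (iff θ η).realize val p ↔ (θ.realize val p ↔ η.realize val p) := by
  simp only [iff, realize_and, realize_imp]; tauto

/-- Equality of two tuples of variables. -/
def eqVars {k : ℕ} (g h : Fin k → V) : QF L V B := conj (List.ofFn fun i => eqVar (g i) (h i))

@[simp] theorem realize_eqVars {k : ℕ} (g h : Fin k → V) (val : V → M) (p : B → Prop) :
    (eqVars g h : QF L V B).realize val p ↔ ∀ i, val (g i) = val (h i) := by
  simp [eqVars]

end QF

variable (E : SymbolMap L' L) (n : ℕ)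

/-- Symbols without a value are second-order variables, so nothing is required of them. -/
def funAxiom {k : ℕ} (f : L'.Functions k) : SkolemMatrix L' L n :=
  match E.onFun f with
  | none => .neg .fls
  | some g => .eq (.var (app n ℕ true (.symb f))) (.func g fun i => .var (tup n _ true i))

def relAxiom {k : ℕ} (r : L'.Relations k) : SkolemMatrix L' L n :=
  match E.onRel r with
  | none => .neg .fls
  | some g => .iff (.bit (true, .symb r)) (.rel g fun i => .var (tup n _ true i))

/-- The recursive definition of the values of a term, at the tuple `y false`. -/
def termAxiom {m : ℕ} : L'.Term (Empty ⊕ Fin m) → SkolemMatrix L' L n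
  | .var (.inl a) => a.elim
  | .var (.inr i) => .eqVar (app n ℕ false (.term (.var (.inr i : Empty ⊕ Fin m)))) (tup n _ false i)
  | .func f ts => .and (.conj (List.ofFn fun i => termAxiom (ts i))) (.and (funAxiom E n f)
      (.imp (.eqVars (fun i => tup n _ true i) fun i => app n ℕ false (.term (ts i)))
        (.eqVar (app n ℕ false (.term (.func f ts))) (app n ℕ true (.symb f)))))

/-- The recursive definition of the truth values of a formula, at the tuple `y false`. -/
def formAxiom : ∀ {m : ℕ}, L'.BoundedFormula Empty m → SkolemMatrix L' L n
  | m, .falsum => .neg (.bit (false, .form (.falsum : L'.BoundedFormula Empty m)))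
  | _, .equal t₁ t₂ => .and (termAxiom E n t₁) (.and (termAxiom E n t₂)
      (.iff (.bit (false, .form (.equal t₁ t₂)))
        (.eqVar (app n ℕ false (.term t₁)) (app n ℕ false (.term t₂)))))
  | _, .rel r ts => .and (.conj (List.ofFn fun i => termAxiom E n (ts i))) (.and (relAxiom E n r)
      (.imp (.eqVars (fun i => tup n _ true i) fun i => app n ℕ false (.term (ts i)))
        (.iff (.bit (false, .form (.rel r ts))) (.bit (true, .symb r)))))
  | _, .imp φ ψ => .and (formAxiom φ) (.and (formAxiom ψ)
      (.iff (.bit (false, .form (.imp φ ψ)))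
        (.imp (.bit (false, .form φ)) (.bit (false, .form ψ)))))
  | m, .all φ => .and (formAxiom φ)
      (.imp (.eqVars (fun i : Fin m => tup n _ false i) fun i : Fin m => tup n _ true i)
        (.and (.imp (.bit (false, .form (.all φ))) (.bit (true, .form φ)))
          (.imp (.eqVar (tup n _ true m) (app n ℕ false (.cex φ)))
            (.imp (.bit (true, .form φ)) (.bit (false, .form (.all φ)))))))

variable {E n} {M : Type w} [L.Structure M]

/-- An infinite tuple that starts with a given finite one. -/
noncomputable def padTuple [Nonempty M] {k : ℕ} (b : Fin k → M) : ℕ → M :=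
  fun i => if h : i < k then b ⟨i, h⟩ else Classical.arbitrary M

@[simp] theorem padTuple_apply [Nonempty M] {k : ℕ} (b : Fin k → M) (i : Fin k) :
    padTuple b i = b i := by
  simp [padTuple]

variable (E) in
/-- The structure that is given by the functions and relations of a Skolem normal form. -/
@[reducible]
noncomputable def SymbolMap.skolemStructure [Nonempty M] (F : SkolemFun L' → (ℕ → M) → M)
    (T : SkolemRel L' → (ℕ → M) → Prop) : L'.Structure M where
  funMap f b := (E.onFun f).elim (F (.symb f) (padTuple b)) fun g => Structure.funMap g b
  RelMap r b := (E.onRel r).elim (T (.symb r) (padTuple b)) fun g => Structure.RelMap g b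

theorem SymbolMap.compatible_skolemStructure [Nonempty M] (F : SkolemFun L' → (ℕ → M) → M)
    (T : SkolemRel L' → (ℕ → M) → Prop) : E.Compatible (E.skolemStructure F T) where
  funMap_eq f g h b := by
    change (E.onFun f).elim _ _ = _
    rw [h]
    rfl
  relMap_iff r g h b := by
    change (E.onRel r).elim _ _ ↔ _
    rw [h]
    rfl

/-- The pair of tuples with the given components. -/
def tuplePair (y z : ℕ → M) : Bool → ℕ → M
  | false => y
  | true => z

@[simp] theorem tuplePair_false (y z : ℕ → M) : tuplePair y z false = y := rfl

@[simp] theorem tuplePair_true (y z : ℕ → M) : tuplePair y z true = z := rfl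

theorem snoc_eq_tuple {m : ℕ} {y z : ℕ → M} (h : ∀ i : Fin m, y i = z i) :
    (Fin.snoc (fun i : Fin m => y i) (z m) : Fin (m + 1) → M) = fun i : Fin (m + 1) => z i := by
  funext i
  refine Fin.lastCases ?_ (fun i => ?_) i
  · simp
  · simp [h i]

/-! ### Functions and relations satisfying the axioms compute truth in the structure they define -/

section Soundness

variable [Nonempty M] {a : Fin n → M} {F : SkolemFun L' → (ℕ → M) → M}
  {T : SkolemRel L' → (ℕ → M) → Prop}

/-- Two tuples suffice for composition: `y false` holds the values of the variables, and `y true` is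
instantiated by the values of the arguments. -/
theorem realize_of_termAxiom {m : ℕ} (t : L'.Term (Empty ⊕ Fin m))
    (h : ∀ y, (termAxiom E n t).Holds a F T y) (y : ℕ → M) :
    F (.term t) y = @Term.realize L' M (E.skolemStructure F T) _
      (Sum.elim default fun i : Fin m => y i) t := by
  let _ := E.skolemStructure F T
  induction t with
  | var c =>
    obtain c | i := c
    · exact c.elim
    · exact h fun _ => y
  | func f ts ih =>
    simp only [termAxiom, SkolemMatrix.Holds, QF.realize_and, QF.realize_conj,
      List.forall_mem_ofFn_iff, QF.realize_imp, QF.realize_eqVars, QF.realize_eqVar, val_app,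
      val_tup] at h
    -- `F (.symb f)` might depend on components beyond the arity of `f`; `skolemStructure` evaluates
    -- it with the same padding, so the two values agree.
    have h₁ := h (tuplePair y (padTuple fun i => F (.term (ts i)) y))
    obtain ⟨-, h₂, h₃⟩ := h₁
    have h₃ := h₃ fun i => by simp
    simp only [tuplePair_false, tuplePair_true] at h₃
    have ih' := fun i => ih i fun y' => (h y').1 i
    rw [h₃, Term.realize]
    simp only [← ih']
    change _ = (E.onFun f).elim _ _
    rw [funAxiom] at h₂
    rcases hf : E.onFun f with _ | g
    · rfl
    · rw [hf] at h₂
      simpa [Term.realize] using h₂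

/-- A universal formula over the first `m` components is handled by tuples `y true` that change only
the component `m`: arbitrarily, to derive each instance, and to the value of `cex`, to derive the
universal formula from one instance. -/
theorem realize_of_formAxiom {m : ℕ} (φ : L'.BoundedFormula Empty m)
    (h : ∀ y, (formAxiom E n φ).Holds a F T y) (y : ℕ → M) :
    T (.form φ) y ↔ @BoundedFormula.Realize L' M (E.skolemStructure F T) _ _ φ default
      fun i : Fin m => y i := by
  let _ := E.skolemStructure F T
  induction φ generalizing y with
  | falsum => exact iff_of_false (h fun _ => y) id
  | equal t₁ t₂ =>
    simp only [formAxiom, SkolemMatrix.Holds, QF.realize_and, QF.realize_iff, QF.realize_bit,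
      QF.realize_eqVar, val_app] at h
    rw [(h fun _ => y).2.2, realize_of_termAxiom t₁ fun y' => (h y').1,
      realize_of_termAxiom t₂ fun y' => (h y').2.1]
    rfl
  | rel r ts =>
    simp only [formAxiom, SkolemMatrix.Holds, QF.realize_and, QF.realize_conj,
      List.forall_mem_ofFn_iff, QF.realize_imp, QF.realize_eqVars, QF.realize_iff, QF.realize_bit,
      val_app, val_tup] at h
    have h₁ := h (tuplePair y (padTuple fun i => F (.term (ts i)) y))
    obtain ⟨-, h₂, h₃⟩ := h₁
    have h₃ := h₃ fun i => by simp
    simp only [tuplePair_false, tuplePair_true] at h₃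
    have ht := fun i => realize_of_termAxiom (ts i) fun y' => (h y').1 i
    rw [h₃, BoundedFormula.Realize]
    simp only [← ht]
    change _ ↔ (E.onRel r).elim _ _
    rw [relAxiom] at h₂
    rcases hr : E.onRel r with _ | g
    · rfl
    · rw [hr] at h₂
      simpa [Term.realize] using h₂
  | imp φ ψ ih₁ ih₂ =>
    simp only [formAxiom, SkolemMatrix.Holds, QF.realize_and, QF.realize_iff, QF.realize_bit,
      QF.realize_imp] at h
    exact (h fun _ => y).2.2.trans
      (imp_congr (ih₁ (fun y' => (h y').1) y) (ih₂ (fun y' => (h y').2.1) y))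
  | @all m φ ih =>
    simp only [formAxiom, SkolemMatrix.Holds, QF.realize_and, QF.realize_bit,
      QF.realize_imp, QF.realize_eqVars, QF.realize_eqVar, val_app, val_tup] at h
    have ih' := ih fun y' => (h y').1
    have hupd : ∀ c, ∀ i : Fin m, y i = Function.update y m c i := fun c i => by
      rw [Function.update_of_ne i.2.ne]
    have hsnoc : ∀ c, (Fin.snoc (fun i : Fin m => y i) c : Fin (m + 1) → M) =
        fun i : Fin (m + 1) => Function.update y m c i := fun c => by
      rw [← snoc_eq_tuple (hupd c), Function.update_self]
    change _ ↔ ∀ c, _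
    simp only [hsnoc, ← ih']
    constructor
    · intro hy c
      exact ((h (tuplePair y (Function.update y m c))).2 (hupd c)).1 hy
    · intro hy
      exact ((h (tuplePair y (Function.update y m (F (.cex φ) y)))).2 (hupd _)).2
        (by simp) (hy _)

end Soundness

/-! ### The intended truth values and Skolem functions satisfy the axioms -/

section Completeness

variable [S : L'.Structure M]

/-- The intended values of the function variables. -/
noncomputable def skolemFunVal [Nonempty M] : SkolemFun L' → (ℕ → M) → M
  | .term (m := m) t, y => t.realize (Sum.elim default fun i : Fin m => y i)
  | .symb f, y => Structure.funMap f fun i => y i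
  | .cex (m := m) φ, y =>
      Classical.epsilon fun c => ¬ φ.Realize default (Fin.snoc (fun i : Fin m => y i) c)

/-- The intended values of the relation variables. -/
def skolemRelVal : SkolemRel L' → (ℕ → M) → Prop
  | .form (m := m) φ, y => φ.Realize default fun i : Fin m => y i
  | .symb r, y => Structure.RelMap r fun i => y i

variable [Nonempty M]

theorem holds_funAxiom (hS : E.Compatible S) (a : Fin n → M) {k : ℕ} (f : L'.Functions k) (y : Bool → ℕ → M) :
    (funAxiom E n f).Holds a skolemFunVal skolemRelVal y := by
  rw [funAxiom]
  rcases hf : E.onFun f with _ | g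
  · exact id
  · exact hS.funMap_eq f g hf _

theorem holds_relAxiom (hS : E.Compatible S) (a : Fin n → M) {k : ℕ} (r : L'.Relations k) (y : Bool → ℕ → M) :
    (relAxiom E n r).Holds a skolemFunVal skolemRelVal y := by
  rw [relAxiom]
  rcases hr : E.onRel r with _ | g
  · exact id
  · simp only [SkolemMatrix.Holds, QF.realize_iff]
    exact hS.relMap_iff r g hr _

theorem holds_termAxiom (hS : E.Compatible S) (a : Fin n → M) {m : ℕ} (t : L'.Term (Empty ⊕ Fin m)) (y : Bool → ℕ → M) :
    (termAxiom E n t).Holds a skolemFunVal skolemRelVal y := by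
  induction t with
  | var c =>
    obtain c | i := c
    · exact c.elim
    · rfl
  | func f ts ih =>
    simp only [termAxiom, SkolemMatrix.Holds, QF.realize_and, QF.realize_conj,
      List.forall_mem_ofFn_iff, QF.realize_imp, QF.realize_eqVars, QF.realize_eqVar, val_app,
      val_tup]
    refine ⟨ih, holds_funAxiom hS a f y, fun h => ?_⟩
    simp only [skolemFunVal, Term.realize] at h ⊢
    simp only [h]

theorem holds_formAxiom (hS : E.Compatible S) (a : Fin n → M) {m : ℕ} (φ : L'.BoundedFormula Empty m) (y : Bool → ℕ → M) :
    (formAxiom E n φ).Holds a skolemFunVal skolemRelVal y := by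
  induction φ with
  | falsum => exact id
  | equal t₁ t₂ =>
    simp only [formAxiom, SkolemMatrix.Holds, QF.realize_and, QF.realize_iff, QF.realize_bit,
      QF.realize_eqVar, val_app]
    exact ⟨holds_termAxiom hS a t₁ y, holds_termAxiom hS a t₂ y, Iff.rfl⟩
  | rel r ts =>
    simp only [formAxiom, SkolemMatrix.Holds, QF.realize_and, QF.realize_conj,
      List.forall_mem_ofFn_iff, QF.realize_imp, QF.realize_eqVars, QF.realize_iff, QF.realize_bit,
      val_app, val_tup]
    refine ⟨fun i => holds_termAxiom hS a (ts i) y, holds_relAxiom hS a r y, fun h => ?_⟩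
    simp only [skolemFunVal, skolemRelVal, BoundedFormula.Realize] at h ⊢
    simp only [h]
  | imp φ ψ ih₁ ih₂ =>
    simp only [formAxiom, SkolemMatrix.Holds, QF.realize_and, QF.realize_iff, QF.realize_bit,
      QF.realize_imp]
    exact ⟨ih₁, ih₂, Iff.rfl⟩
  | @all m φ ih =>
    simp only [formAxiom, SkolemMatrix.Holds, QF.realize_and, QF.realize_bit,
      QF.realize_imp, QF.realize_eqVars, QF.realize_eqVar, val_app, val_tup]
    refine ⟨ih, fun h => ?_⟩
    simp only [skolemRelVal, skolemFunVal]
    rw [← snoc_eq_tuple h]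
    refine ⟨fun hφ => hφ _, fun hm hφ => ?_⟩
    -- If the universal formula failed, the component `m` of `y true` would be a counterexample
    -- chosen by `epsilon`, contradicting `hφ`.
    by_contra hall
    rw [BoundedFormula.Realize, not_forall] at hall
    rw [hm] at hφ
    exact Classical.epsilon_spec hall hφ

end Completeness

/-- The matrix of the Skolem normal form of the statement that some compatible interpretation of the
symbols of `L'` makes `φ` false and `R` true at the tuple of the parameters. -/
def refutationMatrix (E : SymbolMap L' L) {n : ℕ} (R : L'.Relations n) (φ : L'.Sentence) :
    SkolemMatrix L' L n :=
  .and (formAxiom E n φ) (.and (.neg (.bit (false, .form φ)))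
    (.imp (.eqVars (fun j => .inl j) fun j : Fin n => tup n _ false j) (.bit (false, .symb R))))

/-- The parameters occur only in the last conjunct of the matrix, which puts `a` into `R` when `y
false` starts with `a`. As `R` has no value under `E`, its interpretation is among the guessed
relations. -/
theorem exists_holds_refutationMatrix [Nonempty M] {R : L'.Relations n} (hR : E.onRel R = none)
    (φ : L'.Sentence) {A : Set (Fin n → M)} (hA : A.Nonempty) :
    (∃ F T, ∀ a ∈ A, ∀ y, (refutationMatrix E R φ).Holds a F T y) ↔
      ∃ S : L'.Structure M, E.Compatible S ∧ ¬ @Sentence.Realize L' M S φ ∧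
        ∀ a ∈ A, S.RelMap R a := by
  simp only [refutationMatrix, SkolemMatrix.Holds, QF.realize_and, QF.realize_neg, QF.realize_bit,
      QF.realize_imp, QF.realize_eqVars, val_inl, val_tup]
  constructor
  · rintro ⟨F, T, h⟩
    refine ⟨E.skolemStructure F T, E.compatible_skolemStructure F T, ?_, fun a ha => ?_⟩
    -- Without an element of `A` the axioms would hold vacuously and say nothing about the
    -- structure.
    · obtain ⟨a, ha⟩ := hA
      have h' := (h a ha fun _ _ => Classical.arbitrary M).2.1
      rw [realize_of_formAxiom φ fun y => (h a ha y).1] at h'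
      let _ := E.skolemStructure F T
      intro hφ
      refine h' ?_
      have hφ : BoundedFormula.Realize φ default (default : Fin 0 → M) := hφ
      convert hφ
    · change (E.onRel R).elim _ _
      rw [hR]
      exact (h a ha fun _ => padTuple a).2.2 fun j => (padTuple_apply a j).symm
  · rintro ⟨S, hS, hφ, hA⟩
    refine ⟨skolemFunVal, skolemRelVal, fun a ha y => ⟨holds_formAxiom hS a φ y, ?_, fun h => ?_⟩⟩
    · intro h
      refine hφ ?_
      have h : BoundedFormula.Realize φ default fun i : Fin 0 => y false i := h
      change BoundedFormula.Realize φ default (default : Fin 0 → M)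
      convert h
    · have := hA a ha
      rwa [funext h] at this

end TruthAxioms

/-! ### Monotonicity of truth in relation symbols of constant sign -/

section Monotonicity

open FirstOrder Language

/-- Enlarging the relations that occur only positively, or shrinking those that occur only negatively,
preserves truth. -/
theorem realize_of_occursOnly {L : FirstOrder.Language.{u, v}} {α : Type*} {M : Type w}
    (S : ∀ k, L.Relations k → Prop) (S₁ S₂ : L.Structure M)
    (hfun : ∀ (k : ℕ) (f : L.Functions k) (a : Fin k → M), S₁.funMap f a = S₂.funMap f a)
    (hrel : ∀ (k : ℕ) (r : L.Relations k) (a : Fin k → M), ¬ S k r → (S₁.RelMap r a ↔ S₂.RelMap r a))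
    (hS : ∀ (k : ℕ) (r : L.Relations k) (a : Fin k → M), S k r → S₁.RelMap r a → S₂.RelMap r a)
    {m : ℕ} (φ : L.BoundedFormula α m) (b : Bool) (h : occursOnly S b φ) (val : α → M)
    (xs : Fin m → M) :
    if b then @BoundedFormula.Realize L M S₁ α m φ val xs → @BoundedFormula.Realize L M S₂ α m φ val xs
    else @BoundedFormula.Realize L M S₂ α m φ val xs →
      @BoundedFormula.Realize L M S₁ α m φ val xs := by
  have hterm : ∀ {k : ℕ} (t : L.Term (α ⊕ Fin k)) (val : α ⊕ Fin k → M),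
      @Term.realize L M S₁ _ val t = @Term.realize L M S₂ _ val t := by
    intro k t val
    induction t with
    | var c => rfl
    | func f ts ih =>
      simp only [Term.realize, ih]
      exact hfun _ _ _
  induction φ generalizing b with
  | falsum => cases b <;> exact id
  | equal t₁ t₂ =>
    cases b <;> simp [BoundedFormula.Realize, hterm]
  | rel r ts =>
    by_cases hr : S _ r
    · obtain rfl := h hr
      simp only [if_true, BoundedFormula.Realize, hterm]
      exact hS _ r _ hr
    · cases b <;> simp only [if_true, Bool.false_eq_true, if_false, BoundedFormula.Realize, hterm]
      · exact (hrel _ r _ hr).2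
      · exact (hrel _ r _ hr).1
  | imp φ ψ ih₁ ih₂ =>
    have h₁ := ih₁ (!b) h.1 xs
    have h₂ := ih₂ b h.2 xs
    cases b
    · exact fun hi hφ => h₂ (hi (h₁ hφ))
    · exact fun hi hφ => h₂ (hi (h₁ hφ))
  | all φ ih =>
    cases b
    · exact fun hφ c => ih false h (Fin.snoc xs c) (hφ c)
    · exact fun hφ c => ih true h (Fin.snoc xs c) (hφ c)

end Monotonicity

/-! ### Failure of a positive universal second-order sentence -/

namespace Pi11Sentence

open FirstOrder Language

variable {L : FirstOrder.Language.{u, v}} {n : ℕ}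

/-- The signature of the matrix of `Φ`. -/
abbrev language (Φ : Pi11Sentence L n) : FirstOrder.Language :=
  (L.sum (relVarLang n)).sum (secondOrderVars Φ.relAr Φ.funAr)

/-- The symbols of `L` in the signature of the matrix. -/
def symbolMap (Φ : Pi11Sentence L n) : SymbolMap Φ.language L where
  onFun
    | .inl (.inl f) => some f
    | _ => none
  onRel
    | .inl (.inl r) => some r
    | _ => none

/-- The symbol `R` in the signature of the matrix. -/
def relVar (Φ : Pi11Sentence L n) : Φ.language.Relations n := .inl (.inr ⟨rfl⟩)

variable {M : Type w} [L.Structure M]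

/-- If the matrix fails for some `R ⊇ A`, then by positivity it fails for `A` itself with the same
second-order variables; conversely take `R = A`. -/
theorem not_realize_iff (Φ : Pi11Sentence L n) (hΦ : Φ.OnlyPositive) (A : Set (Fin n → M)) :
    ¬ Φ.Realize M A ↔ ∃ S : Φ.language.Structure M, Φ.symbolMap.Compatible S ∧
      ¬ @Sentence.Realize _ M S Φ.matrix ∧ ∀ a ∈ A, S.RelMap Φ.relVar a := by
  let _ : (relVarLang n).Structure M := relVarStructure A
  constructor
  · intro h
    rw [Realize, not_forall] at h
    obtain ⟨I, hI⟩ := h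
    refine ⟨inferInstance, ⟨?_, ?_⟩, hI, fun a ha => ha⟩
    · rintro k ((f | f) | f) g hg b <;> cases hg
      rfl
    · rintro k ((f | f) | f) g hg b <;> cases hg
      rfl
  · rintro ⟨S, hS, hφ, hA⟩ h
    refine hφ ?_
    let I : (secondOrderVars Φ.relAr Φ.funAr).Structure M :=
      { funMap := fun f b => S.funMap (.inr f) b
        RelMap := fun r b => S.RelMap (.inr r) b }
    -- The two structures differ only at `R`, interpreted by `A` in the first and by a superset of
    -- `A` in `S`.
    refine realize_of_occursOnly _ (@sumStructure _ _ M inferInstance I) S ?_ ?_ ?_ Φ.matrix true hΦ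
      _ _ (h I)
    · rintro k ((f | f) | f) b
      · exact (hS.funMap_eq _ f rfl b).symm
      · exact f.elim
      · rfl
    · rintro k ((r | r) | r) b hr
      · exact (hS.relMap_iff _ r rfl b).symm
      · exact absurd ⟨r, rfl⟩ hr
      · rfl
    · rintro k r b ⟨⟨rfl⟩, rfl⟩ hb
      exact hA b hb

end Pi11Sentence

theorem mainTheorem3 {L : FirstOrder.Language.{u, v}} (n : ℕ) (x : Fin n → ℕ)
    (hx : Function.Injective x) (Φ : Pi11Sentence L n) (hΦ : Φ.OnlyPositive) :
    ∃ ψ : PDLFormula L, ψ.free ⊆ Set.range x ∧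
      ∀ (M : Type w) [Nonempty M] [L.Structure M] (W : Set ℕ) (X : Set (PDLAssignment M)),
        Set.range x ⊆ W → IsTeamOn W X →
          (ParaSat X ψ ↔ X.Nonempty ∧ Φ.Realize M (teamRel X x)) := by
  obtain ⟨χ, hfree, hχ⟩ := exists_pdlFormula_of_skolemForm.{u, v, w} hx
    (elimBits (refutationMatrix Φ.symbolMap Φ.relVar Φ.matrix))
  -- The outer negation hands `χ` to Abelard as its verifier.
  refine ⟨.neg χ, hfree, fun M _ _ W X hW hX => ?_⟩
  -- All assignments of the team are defined on the variables `x`, so the default of `val` plays no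
  -- role.
  have hA : teamRel X x = (fun s j => s.val (x j)) '' X := by
    ext a
    refine exists_congr fun s => and_congr_right fun hs => ?_
    rw [funext_iff]
    refine forall_congr' fun j => ?_
    have : s (x j) ≠ none := by
      have h : x j ∈ s.dom := by
        rw [hX s hs]
        exact hW ⟨j, rfl⟩
      exact h
    obtain ⟨m, hm⟩ := Option.ne_none_iff_exists'.1 this
    change _ ↔ s.val (x j) = a j
    rw [PDLAssignment.val_of_eq_some hm, hm, Option.some_inj]
  rw [paraSat_iff_not_teamSat]
  change ¬ TeamSat χ .abelard X ↔ _
  rw [hχ M X]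
  have hskolem := realize_elimBits (refutationMatrix Φ.symbolMap Φ.relVar Φ.matrix) (teamRel X x)
  rw [hA] at hskolem ⊢
  simp only [Set.forall_mem_image] at hskolem
  rw [hskolem]
  -- For the empty team any functions and relations satisfy the matrix vacuously, so both sides are
  -- false.
  rcases X.eq_empty_or_nonempty with rfl | hne
  · simp
  · have h := (exists_holds_refutationMatrix (M := M) (R := Φ.relVar) (E := Φ.symbolMap) rfl Φ.matrix
      (hne.image fun s j => s.val (x j))).trans (Φ.not_realize_iff hΦ _).symm
    simp only [Set.forall_mem_image] at h
    simp only [hne, true_and]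
    exact not_iff_comm.1 h.symm
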